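/- Let $\Bbbk$ be a field of characteristic $0$, let $d\ge 1$, and let $\Delta$ be a simplicial complex of dimension $d$ on the vertex set $\mathsf V=[n]$ with complete $(d-1)$-skeleton (every nonempty subset of $[n]$ with at most $d$ elements is a face). Let $A=\Bbbk\langle\Delta\rangle=\bigwedge(e_1,\dots,e_n)/(e_\sigma : \sigma\notin\Delta)$ be the exterior Stanley–Reisner ring, $A^1=\Bbbk^n$, and $S=\Bbbk[x_1,\dots,x_n]$. For $i\ge 0$ define the jump resonance locus $$\mathcal R^i(\Delta)=\{a\in\Bbbk^n : H^i(A^\bullet, u\mapsto a\cdot u)\neq 0\}$$ and the support resonance locus $\mathfrak R_i(\Delta)=V(\operatorname{Ann}_S W_i(\Delta))\subseteq\Bbbk^n$, where $W_i(\Delta)=H_i(A_\bullet\otimes_\Bbbk S,\partial)$ is the $i$-th Koszul module: here $A_i=(A^i)^\vee$ and $\partial(\varphi\otimes s)=\sum_{j}\varphi(e_j\,\cdot\,)\otimes x_j s$. For $\mathsf V'\subseteq\mathsf V$ let $\Delta_{\mathsf V'}$ be the restriction of $\Delta$ to $\mathsf V'$ and let $\Bbbk^{\mathsf V'}\subseteq\Bbbk^n$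 be the coordinate subspace spanned by the basis vectors indexed by $\mathsf V'$. Then: 1. For every $i\neq d+1$, $\mathfrak R_i(\Delta)$ and $\mathcal R^i(\Delta)$ agree away from $0$. More precisely, $\mathfrak R_i(\Delta)=\mathcal R^i(\Delta)$, except possibly when $1\le i\le d$, $\mathfrak R_i(\Delta)=\emptyset$ and $\mathcal R^i(\Delta)=\{0\}$. 2. $\mathfrak R_{d+1}(\Delta)$ is either $\emptyset$ or $\Bbbk^n$. 3. $\displaystyle \mathcal R^d(\Delta)=\{0\}\cup\bigcup_{\mathsf V'}\Bbbk^{\mathsf V'}$, where $\mathsf V'$ runs over the subsets of $\mathsf V$ that are maximal with $\widetilde H_{d-1}(\Delta_{\mathsf V'};\Bbbk)\neq 0$. (The term $\{0\}$ matters only if there is no such $\mathsf V'$.) -/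

import Mathlib

open scoped TensorProduct

noncomputable section

namespace Resonance

/-! ### Simplicial complexes and reduced simplicial homology

`AbstractSimplicialComplex (Fin n)` is Mathlib's type of simplicial complexes on the vertex set
`{0, …, n - 1}`; its members are the *nonempty* faces, and all singletons are faces. The empty
simplex, which is also a simplex of every complex, is added by hand where it is needed. -/

/-- The restriction `Δ_V' = {τ ∈ Δ | τ ⊆ V'}` of a simplicial complex to a set of vertices. -/
def restrict {n : ℕ} (Δ : AbstractSimplicialComplex (Fin n)) (V' : Finset (Fin n)) :
    PreAbstractSimplicialComplex (Fin n) where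
  faces := {τ | τ ∈ Δ ∧ τ ⊆ V'}
  isRelLowerSet_faces := by
    rintro τ ⟨hτ, hV⟩
    have h := Δ.isRelLowerSet_faces hτ
    exact ⟨h.1, fun ρ hρ hne => ⟨h.2 hρ hne, hρ.trans hV⟩⟩

/-- The quotient `Z / B` of two submodules `B ≤ Z` of a module (in general `Z / (Z ∩ B)`). -/
abbrev Subquotient {R M : Type*} [Ring R] [AddCommGroup M] [Module R M] (Z B : Submodule R M) :
    Type _ :=
  Z ⧸ B.submoduleOf Z

variable (k : Type*) [Field k] {n : ℕ}

/-- The boundary operator on formal combinations of finite sets of vertices,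
`[v₀ < ⋯ < v_q] ↦ ∑ⱼ (-1)^j [v₀, …, v̂ⱼ, …, v_q]`. It sends `[v]` to `[∅]` (augmentation) and
`[∅]` to `0`. -/
def boundary : (Finset (Fin n) →₀ k) →ₗ[k] (Finset (Fin n) →₀ k) :=
  Finsupp.linearCombination k fun σ =>
    ∑ v ∈ σ, Finsupp.single (σ.erase v) ((-1 : k) ^ (σ.filter (· < v)).card)

/-- The augmented simplicial chains of dimension `q` of `K` with coefficients in `k`: combinations
of the simplices with `q + 1` vertices, where `∅` is the unique simplex of dimension `-1`. -/
def chains (K : PreAbstractSimplicialComplex (Fin n)) (q : ℤ) : Submodule k (Finset (Fin n) →₀ k) :=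
  Finsupp.supported k k {σ | (σ = ∅ ∨ σ ∈ K) ∧ (σ.card : ℤ) = q + 1}

/-- The reduced simplicial cycles of dimension `q`. -/
def cycles (K : PreAbstractSimplicialComplex (Fin n)) (q : ℤ) : Submodule k (Finset (Fin n) →₀ k) :=
  chains k K q ⊓ LinearMap.ker (boundary k)

/-- The simplicial boundaries of dimension `q`. -/
def boundaries (K : PreAbstractSimplicialComplex (Fin n)) (q : ℤ) :
    Submodule k (Finset (Fin n) →₀ k) :=
  (chains k K (q + 1)).map (boundary k)

/-- The reduced simplicial homology `H̃_q(K; k)`. -/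
abbrev ReducedHomology (K : PreAbstractSimplicialComplex (Fin n)) (q : ℤ) : Type _ :=
  Subquotient (cycles k K q) (boundaries k K q)

/-! ### The exterior Stanley–Reisner ring -/

/-- The exterior algebra `E = ⋀(e₁, …, e_n)`. -/
abbrev Ext (n : ℕ) : Type _ := ExteriorAlgebra k (Fin n → k)

/-- The exterior monomial `e_σ = e_{i₁} ∧ ⋯ ∧ e_{i_s}` of `σ = {i₁ < ⋯ < i_s}`. -/
def extMonomial (σ : Finset (Fin n)) : Ext k n := (Pi.basisFun k (Fin n)).ExteriorAlgebra σ

/-- The relations `e_σ = 0` for the non-faces `σ` of `Δ`. -/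
def nonFaceRel (Δ : AbstractSimplicialComplex (Fin n)) (x y : Ext k n) : Prop :=
  ∃ σ : Finset (Fin n), σ.Nonempty ∧ σ ∉ Δ ∧ x = extMonomial k σ ∧ y = 0

/-- The exterior Stanley–Reisner ring `k⟨Δ⟩ = E / J_Δ`, where `J_Δ` is the (two-sided) ideal
generated by the monomials `e_σ` of the non-faces `σ` of `Δ`. -/
def ExtSR (Δ : AbstractSimplicialComplex (Fin n)) : Type _ := RingQuot (nonFaceRel k Δ)

variable (Δ : AbstractSimplicialComplex (Fin n))

instance : Ring (ExtSR k Δ) := inferInstanceAs (Ring (RingQuot (nonFaceRel k Δ)))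

instance : Algebra k (ExtSR k Δ) := inferInstanceAs (Algebra k (RingQuot (nonFaceRel k Δ)))

/-- The quotient map `E → k⟨Δ⟩`. -/
def mkExtSR : Ext k n →ₐ[k] ExtSR k Δ := RingQuot.mkAlgHom k (nonFaceRel k Δ)

/-- The degree `i` part `A^i` of `A = k⟨Δ⟩`, the image of `⋀^i k^n`. -/
def deg (i : ℕ) : Submodule k (ExtSR k Δ) :=
  (⋀[k]^i (Fin n → k)).map (mkExtSR k Δ).toLinearMap

/-- The identification `k^n ≅ A^1`, `a ↦ ∑ᵢ aᵢ eᵢ`. -/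
def linearForm : (Fin n → k) →ₗ[k] ExtSR k Δ :=
  (mkExtSR k Δ).toLinearMap ∘ₗ ExteriorAlgebra.ι k

theorem linearForm_mul_mem (a : Fin n → k) (i : ℕ) :
    ∀ u ∈ deg k Δ i, LinearMap.mulLeft k (linearForm k Δ a) u ∈ deg k Δ (i + 1) := by
  rintro _ ⟨u, hu, rfl⟩
  refine ⟨ExteriorAlgebra.ι k a * u, ?_, by simp [linearForm]⟩
  change _ ∈ LinearMap.range (ExteriorAlgebra.ι k) ^ (i + 1)
  rw [pow_succ']
  exact Submodule.mul_mem_mul ⟨a, rfl⟩ hu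

/-- The differential `δ_a^i : A^i → A^{i+1}`, `u ↦ a · u`, for `a ∈ k^n = A^1`. -/
def delta (a : Fin n → k) (i : ℕ) : deg k Δ i →ₗ[k] deg k Δ (i + 1) :=
  (LinearMap.mulLeft k (linearForm k Δ a)).restrict (linearForm_mul_mem k Δ a i)

/-! ### Jump resonance -/

/-- The coboundaries in `A^i` of the complex `(A, δ_a)`, where `A^{-1} = 0`. -/
def coboundaries (a : Fin n → k) : (i : ℕ) → Submodule k (deg k Δ i)
  | 0 => ⊥
  | i + 1 => LinearMap.range (delta k Δ a i)

/-- The cohomology `H^i(A, δ_a)`. -/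
abbrev Cohomology (a : Fin n → k) (i : ℕ) : Type _ :=
  Subquotient (LinearMap.ker (delta k Δ a i)) (coboundaries k Δ a i)

/-- The jump resonance locus `{a ∈ A^1 | H^i(A, δ_a) ≠ 0}`, as a subset of `k^n = A^1`. -/
def jumpResonance (i : ℕ) : Set (Fin n → k) :=
  {a | Nontrivial (Cohomology k Δ a i)}

/-! ### Koszul modules and support resonance -/

/-- The module `A_i ⊗ S` over `S = k[x₁, …, x_n]`, with `A_i` the dual vector space of `A^i`. -/
abbrev KoszulTerm (i : ℕ) : Type _ :=
  MvPolynomial (Fin n) k ⊗[k] Module.Dual k (deg k Δ i)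

/-- The differential `∂_{i+1} : A_{i+1} ⊗ S → A_i ⊗ S` dual to
`A^i ⊗ S → A^{i+1} ⊗ S`, `u ⊗ s ↦ ∑ⱼ eⱼ u ⊗ xⱼ s`; explicitly
`φ ⊗ s ↦ ∑ⱼ φ(eⱼ · _) ⊗ xⱼ s`. -/
def koszulDiff (i : ℕ) : KoszulTerm k Δ (i + 1) →ₗ[MvPolynomial (Fin n) k] KoszulTerm k Δ i :=
  ∑ j : Fin n, (MvPolynomial.X j : MvPolynomial (Fin n) k) •
    (delta k Δ (Pi.single j 1) i).dualMap.baseChange (MvPolynomial (Fin n) k)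

/-- The kernel of `∂_i : A_i ⊗ S → A_{i-1} ⊗ S`, where `A_{-1} = 0`. -/
def koszulCycles : (i : ℕ) → Submodule (MvPolynomial (Fin n) k) (KoszulTerm k Δ i)
  | 0 => ⊤
  | i + 1 => LinearMap.ker (koszulDiff k Δ i)

/-- The Koszul module in weight `i`, `W_i(Δ) = H_i(A_• ⊗ S, ∂)`. -/
abbrev KoszulModule (i : ℕ) : Type _ :=
  Subquotient (koszulCycles k Δ i) (LinearMap.range (koszulDiff k Δ i))

/-- The support resonance locus: the zero set in `k^n` of the annihilator of `W_i(Δ)`. -/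
def supportResonance (i : ℕ) : Set (Fin n → k) :=
  MvPolynomial.zeroLocus k (Module.annihilator (MvPolynomial (Fin n) k) (KoszulModule k Δ i))

/-- The coordinate subspace `k^V'` of `k^n` spanned by the basis vectors with index in `V'`. -/
def coordSubspace (V' : Finset (Fin n)) : Submodule k (Fin n → k) :=
  Submodule.span k ((fun j => Pi.single j (1 : k)) '' (V' : Set (Fin n)))

end Resonance

end

noncomputable section

namespace Resonance

/-! ### Twisted boundary operators -/

section Twisted

variable {R : Type*} [CommRing R] {n : ℕ}

/-! Everything is dualized to chains on finite vertex sets. The monomials of the faces form a basis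
of `A`, so the dual of `δ_a` is the twisted boundary `∂_a [σ] = ∑ ± a_v [σ \ v]`, and the Koszul
differential is the same operator over `S` with the generic twist `X`. Thus `a ∈ 𝓡^i` means that
`∂_a` is not exact on the faces with `i` vertices (`mem_jumpResonance_iff`), and `f` annihilates
`W_i` when `f` times any `∂_X`-cycle is a boundary (`mem_annihilator_koszulModule_iff`).

The engine is the homotopy `∂_a c_u + c_u ∂_a = a_u` (`twistedBoundary_coneOp`): the Koszul complex
on all vertex sets is exact wherever some `a_u` is invertible. For `i ≤ d` all `i`-sets are faces,
so near `a ≠ 0` the cycles of degree `i` are generated by the boundaries of arbitrary `(i+1)`-sets.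
A cycle at `a` therefore lifts to a cycle over `S`, which gives one comparison of the loci; Nakayama
at the maximal ideal of `a` gives the other. At the origin, `𝓡^i` contains `0` because `∂_0 = 0`,
while the support locus is a closed cone, so it contains `0` unless it is empty. In degree `d + 1`
there are no boundaries, so `W_{d+1}` sits in a free module and its annihilator is `0` or
everything. Above that all terms vanish.

For the components, rescaling turns a nowhere vanishing twist into the ordinary boundary. Hence
points with support exactly `V'` resonate when `Δ_V'` has homology, and closedness of the support
locus extends this to all nonzero points of `k^V'`. Conversely, a resonant `a` must have its support
inside some `V'` with homology: otherwise `exactAt_of_forall_restrict` splits a cycle by the part of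
each face outside the support of `a` and bounds each piece. -/

/-- The sign `(-1)^#{w ∈ σ | w < v}` of a vertex `v` relative to `σ`. -/
def vertexSign (R : Type*) [CommRing R] {n : ℕ} (σ : Finset (Fin n)) (v : Fin n) : R :=
  (-1) ^ (σ.filter (· < v)).card

theorem vertexSign_mul_self (σ : Finset (Fin n)) (v : Fin n) :
    vertexSign R σ v * vertexSign R σ v = 1 := by
  rw [vertexSign, ← mul_pow]; simp

theorem vertexSign_erase_self (σ : Finset (Fin n)) (v : Fin n) :
    vertexSign R (σ.erase v) v = vertexSign R σ v := by
  unfold vertexSign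
  rw [Finset.filter_erase, Finset.erase_eq_of_notMem (by simp)]

theorem vertexSign_insert_self (σ : Finset (Fin n)) (v : Fin n) :
    vertexSign R (insert v σ) v = vertexSign R σ v := by
  unfold vertexSign
  rw [Finset.filter_insert, if_neg (lt_irrefl v)]

theorem vertexSign_insert_of_lt {σ : Finset (Fin n)} {v w : Fin n} (hv : v ∉ σ) (h : v < w) :
    vertexSign R (insert v σ) w = -vertexSign R σ w := by
  unfold vertexSign
  rw [Finset.filter_insert, if_pos h, Finset.card_insert_of_notMem (by simp [hv]), pow_succ]
  simp

theorem vertexSign_insert_of_gt {σ : Finset (Fin n)} {v w : Fin n} (h : w < v) :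
    vertexSign R (insert v σ) w = vertexSign R σ w := by
  unfold vertexSign
  rw [Finset.filter_insert, if_neg (not_lt.mpr h.le)]

theorem vertexSign_insert_mul {σ : Finset (Fin n)} {v w : Fin n} (hv : v ∉ σ) (hw : w ∉ σ)
    (h : v ≠ w) :
    vertexSign R (insert v σ) w * vertexSign R σ v
      = -(vertexSign R (insert w σ) v * vertexSign R σ w) := by
  rcases lt_or_gt_of_ne h with h | h
  · rw [vertexSign_insert_of_lt hv h, vertexSign_insert_of_gt h]; ring
  · rw [vertexSign_insert_of_lt hw h, vertexSign_insert_of_gt h]; ring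

/-- The twisted boundary `[σ] ↦ ∑_{v ∈ σ} ± a_v [σ \ v]`. -/
def twistedBoundary (a : Fin n → R) : (Finset (Fin n) →₀ R) →ₗ[R] (Finset (Fin n) →₀ R) :=
  Finsupp.linearCombination R fun σ =>
    ∑ v ∈ σ, Finsupp.single (σ.erase v) (vertexSign R σ v * a v)

/-- The cone operator `[σ] ↦ ± [σ ∪ u]`, zero on the sets containing `u`. -/
def coneOp (R : Type*) [CommRing R] {n : ℕ} (u : Fin n) :
    (Finset (Fin n) →₀ R) →ₗ[R] (Finset (Fin n) →₀ R) :=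
  Finsupp.linearCombination R fun σ =>
    if u ∈ σ then 0 else Finsupp.single (insert u σ) (vertexSign R σ u)

theorem twistedBoundary_single (a : Fin n → R) (σ : Finset (Fin n)) (c : R) :
    twistedBoundary a (Finsupp.single σ c)
      = ∑ v ∈ σ, Finsupp.single (σ.erase v) (c * (vertexSign R σ v * a v)) := by
  rw [twistedBoundary, Finsupp.linearCombination_single, Finset.smul_sum]
  simp only [Finsupp.smul_single, smul_eq_mul]

theorem coneOp_single (u : Fin n) (σ : Finset (Fin n)) (c : R) :
    coneOp R u (Finsupp.single σ c)
      = if u ∈ σ then 0 else Finsupp.single (insert u σ) (c * vertexSign R σ u) := by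
  rw [coneOp, Finsupp.linearCombination_single]
  split_ifs <;> simp

theorem boundary_eq_twistedBoundary (k : Type*) [Field k] :
    boundary k = twistedBoundary (1 : Fin n → k) := by
  simp [boundary, twistedBoundary, vertexSign]

/-- The cone is a contracting homotopy up to the scalar `a u`. On a basis set only the term removing
`u` survives; the others cancel in pairs because exchanging two insertions changes the sign. -/
theorem twistedBoundary_coneOp (a : Fin n → R) (u : Fin n) (z : Finset (Fin n) →₀ R) :
    twistedBoundary a (coneOp R u z) = a u • z - coneOp R u (twistedBoundary a z) := by
  rw [eq_sub_iff_add_eq]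
  induction z using Finsupp.induction_linear with
  | zero => simp
  | add x y hx hy =>
    simp only [map_add, smul_add, ← hx, ← hy]; abel
  | single σ c =>
    rw [twistedBoundary_single, coneOp_single, map_sum]
    simp only [coneOp_single]
    by_cases hu : u ∈ σ
    · rw [if_pos hu, map_zero, zero_add, Finset.sum_eq_single u]
      · rw [if_neg (Finset.notMem_erase u σ), Finset.insert_erase hu, vertexSign_erase_self,
          Finsupp.smul_single]
        congr 1
        linear_combination c * a u * vertexSign_mul_self (R := R) σ u
      · intro v _ hvu
        rw [if_pos (Finset.mem_erase.mpr ⟨hvu.symm, hu⟩)]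
      · exact fun h => absurd hu h
    · rw [if_neg hu, twistedBoundary_single, Finset.sum_insert hu, Finset.erase_insert hu,
        Finsupp.smul_single, vertexSign_insert_self, add_assoc, ← Finset.sum_add_distrib,
        Finset.sum_eq_zero, add_zero]
      · congr 1
        linear_combination c * a u * vertexSign_mul_self (R := R) σ u
      · intro v hv
        have hvu : v ≠ u := fun h => hu (h ▸ hv)
        obtain ⟨τ, hτ, rfl⟩ : ∃ τ, v ∉ τ ∧ insert v τ = σ :=
          ⟨σ.erase v, Finset.notMem_erase _ _, Finset.insert_erase hv⟩
        have huτ : u ∉ τ := fun h => hu (Finset.mem_insert_of_mem h)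
        rw [Finset.erase_insert hτ, if_neg huτ, Finset.insert_comm, Finset.erase_insert
          (by simp [hvu, hτ]), ← Finsupp.single_add, Finsupp.single_eq_zero]
        have h := vertexSign_insert_mul (R := R) hτ huτ hvu
        simp only [vertexSign_insert_self]
        have h2 := vertexSign_mul_self (R := R) τ v
        have h3 := vertexSign_mul_self (R := R) (insert u τ) v
        linear_combination c * a v * (vertexSign R (insert u τ) v * vertexSign R τ v) * h
          - c * a v * vertexSign R (insert v τ) u * vertexSign R (insert u τ) v * h2
          - c * a v * vertexSign R τ v * vertexSign R τ u * h3

theorem twistedBoundary_twistedBoundary (a : Fin n → R) (z : Finset (Fin n) →₀ R) :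
    twistedBoundary a (twistedBoundary a z) = 0 := by
  induction z using Finsupp.induction_linear with
  | zero => simp
  | add x y hx hy => simp [hx, hy]
  | single σ c =>
    simp only [twistedBoundary_single, map_sum]
    rw [Finset.sum_sigma']
    -- Removing `v` then `w` cancels against removing `w` then `v`.
    refine Finset.sum_involution (fun p _ => ⟨p.2, p.1⟩) ?_ ?_ ?_ ?_
    · rintro ⟨v, w⟩ hvw
      obtain ⟨hv, hne, hw⟩ : v ∈ σ ∧ w ≠ v ∧ w ∈ σ := by simpa using hvw
      obtain ⟨τ, hvτ, hwτ, rfl⟩ : ∃ τ, v ∉ τ ∧ w ∉ τ ∧ insert v (insert w τ) = σ :=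
        ⟨(σ.erase v).erase w, by simp, by simp, by
          rw [Finset.insert_erase (Finset.mem_erase.mpr ⟨hne, hw⟩), Finset.insert_erase hv]⟩
      have e1 : (insert v (insert w τ)).erase v = insert w τ :=
        Finset.erase_insert (by simp [hne.symm, hvτ])
      have e2 : (insert v (insert w τ)).erase w = insert v τ := by
        rw [Finset.insert_comm]; exact Finset.erase_insert (by simp [hne, hwτ])
      simp only [e1, e2, Finset.erase_insert hvτ, Finset.erase_insert hwτ]
      rw [← Finsupp.single_add, Finsupp.single_eq_zero, vertexSign_insert_self,
        vertexSign_insert_self, vertexSign_insert_self, Finset.insert_comm, vertexSign_insert_self]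
      have h := vertexSign_insert_mul (R := R) hvτ hwτ hne.symm
      linear_combination c * a v * a w * h
    · rintro ⟨v, w⟩ hvw _ h
      simp at hvw h
      exact hvw.2.1 h.1
    · rintro ⟨v, w⟩ hvw
      simp at hvw ⊢
      tauto
    · simp

theorem twistedBoundary_smul (t : R) (a : Fin n → R) (z : Finset (Fin n) →₀ R) :
    twistedBoundary (t • a) z = t • twistedBoundary a z := by
  induction z using Finsupp.induction_linear with
  | zero => simp
  | add x y hx hy => simp [hx, hy]
  | single σ c =>
    simp only [twistedBoundary_single, Finset.smul_sum, Finsupp.smul_single]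
    refine Finset.sum_congr rfl fun v _ => ?_
    congr 1
    simp; ring

theorem twistedBoundary_zero (z : Finset (Fin n) →₀ R) :
    twistedBoundary (0 : Fin n → R) z = 0 := by
  simpa using twistedBoundary_smul (0 : R) (0 : Fin n → R) z

/-- Base change of chains along a ring homomorphism. -/
theorem mapRange_twistedBoundary {R' : Type*} [CommRing R'] (f : R →+* R') (a : Fin n → R)
    (z : Finset (Fin n) →₀ R) :
    (twistedBoundary a z).mapRange f f.map_zero
      = twistedBoundary (fun v => f (a v)) (z.mapRange f f.map_zero) := by
  induction z using Finsupp.induction_linear with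
  | zero => simp
  | add x y hx hy =>
    rw [map_add, Finsupp.mapRange_add (map_add f), Finsupp.mapRange_add (map_add f), map_add,
      hx, hy]
  | single σ c =>
    rw [Finsupp.mapRange_single, twistedBoundary_single, twistedBoundary_single]
    change Finsupp.mapRange.addMonoidHom (f : R →+ R') _ = _
    rw [map_sum]
    refine Finset.sum_congr rfl fun v _ => ?_
    simp [vertexSign, -Finsupp.single_mul]

theorem twistedBoundary_mem {a : Fin n → R} {P Q : Set (Finset (Fin n))}
    (h : ∀ σ ∈ P, ∀ v ∈ σ, σ.erase v ∈ Q) {z : Finset (Fin n) →₀ R}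
    (hz : z ∈ Finsupp.supported R R P) : twistedBoundary a z ∈ Finsupp.supported R R Q := by
  rw [twistedBoundary, Finsupp.linearCombination_apply]
  refine Submodule.sum_mem _ fun σ hσ => Submodule.smul_mem _ _ <| Submodule.sum_mem _ fun v hv => ?_
  exact Finsupp.single_mem_supported _ _ (h σ (hz hσ) v hv)

theorem coneOp_mem {u : Fin n} {P Q : Set (Finset (Fin n))}
    (h : ∀ σ ∈ P, u ∉ σ → insert u σ ∈ Q) {z : Finset (Fin n) →₀ R}
    (hz : z ∈ Finsupp.supported R R P) : coneOp R u z ∈ Finsupp.supported R R Q := by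
  rw [coneOp, Finsupp.linearCombination_apply]
  refine Submodule.sum_mem _ fun σ hσ => Submodule.smul_mem _ _ ?_
  split_ifs with hu
  · exact zero_mem _
  · exact Finsupp.single_mem_supported _ _ (h σ (hz hσ) hu)

/-- Selecting the part of a chain indexed by `p` may exchange one twist for another: it suffices
that the coefficients agree face by face, with `p` tested after removal for `b` and before removal
for `a`. -/
theorem filter_twistedBoundary {a b : Fin n → R} {p : Finset (Fin n) → Prop} [DecidablePred p]
    {P : Set (Finset (Fin n))}
    (h : ∀ σ ∈ P, ∀ v ∈ σ, (if p (σ.erase v) then b v else 0) = if p σ then a v else 0)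
    {z : Finset (Fin n) →₀ R} (hz : z ∈ Finsupp.supported R R P) :
    (twistedBoundary b z).filter p = twistedBoundary a (z.filter p) := by
  change Finsupp.filterAddHom p _ = (twistedBoundary a).toAddMonoidHom.comp (Finsupp.filterAddHom p) z
  rw [← Finsupp.sum_single z, Finsupp.sum]
  simp only [map_sum]
  refine Finset.sum_congr rfl fun σ hσ => ?_
  change Finsupp.filter p _ = twistedBoundary a (Finsupp.filter p _)
  have e : twistedBoundary a (Finsupp.filter p (Finsupp.single σ (z σ)))
      = ∑ v ∈ σ, Finsupp.single (σ.erase v) (z σ * (vertexSign R σ v * if p σ then a v else 0)) := by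
    by_cases hp : p σ
    · rw [Finsupp.filter_single_of_pos _ hp, twistedBoundary_single]; simp [hp]
    · rw [Finsupp.filter_single_of_neg _ hp, map_zero]; simp [hp]
  rw [e, twistedBoundary_single]
  change Finsupp.filterAddHom p _ = _
  rw [map_sum]
  refine Finset.sum_congr rfl fun v hv => ?_
  rw [← h σ (hz hσ) v hv]
  change Finsupp.filter p _ = _
  by_cases hp : p (σ.erase v)
  · rw [Finsupp.filter_single_of_pos _ hp]; simp [hp]
  · rw [Finsupp.filter_single_of_neg _ hp]; simp [hp]

theorem filter_coneOp {u : Fin n} {p : Finset (Fin n) → Prop} [DecidablePred p]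
    (h : ∀ σ, p (insert u σ) ↔ p σ) (z : Finset (Fin n) →₀ R) :
    (coneOp R u z).filter p = coneOp R u (z.filter p) := by
  induction z using Finsupp.induction_linear with
  | zero => simp [Finsupp.filter_zero]
  | add x y hx hy => simp only [map_add, Finsupp.filter_add, hx, hy]
  | single σ c =>
    rw [coneOp_single]
    by_cases hp : p σ
    · rw [Finsupp.filter_single_of_pos _ hp, coneOp_single]
      split_ifs
      · exact Finsupp.filter_zero _
      · rw [Finsupp.filter_single_of_pos _ ((h σ).mpr hp)]
    · rw [Finsupp.filter_single_of_neg _ hp, map_zero]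
      split_ifs
      · exact Finsupp.filter_zero _
      · rw [Finsupp.filter_single_of_neg _ (mt (h σ).mp hp)]

theorem twistedBoundary_congr {a b : Fin n → R} {P : Set (Finset (Fin n))}
    (h : ∀ σ ∈ P, ∀ v ∈ σ, a v = b v) {z : Finset (Fin n) →₀ R}
    (hz : z ∈ Finsupp.supported R R P) : twistedBoundary a z = twistedBoundary b z := by
  simp only [twistedBoundary, Finsupp.linearCombination_apply]
  refine Finsupp.sum_congr fun σ hσ => ?_
  rw [Finset.sum_congr rfl fun v hv => by rw [h σ (hz hσ) v hv]]

/-- Diagonal rescaling `[σ] ↦ (∏_{v ∈ σ} r_v) [σ]` of chains. -/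
def rescale (r : Fin n → R) : (Finset (Fin n) →₀ R) →ₗ[R] (Finset (Fin n) →₀ R) :=
  Finsupp.linearCombination R fun σ => Finsupp.single σ (∏ v ∈ σ, r v)

theorem rescale_single (r : Fin n → R) (σ : Finset (Fin n)) (c : R) :
    rescale r (Finsupp.single σ c) = Finsupp.single σ (c * ∏ v ∈ σ, r v) := by
  simp [rescale, Finsupp.linearCombination_single]

theorem rescale_mem {r : Fin n → R} {P : Set (Finset (Fin n))} {z : Finset (Fin n) →₀ R}
    (hz : z ∈ Finsupp.supported R R P) : rescale r z ∈ Finsupp.supported R R P := by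
  rw [rescale, Finsupp.linearCombination_apply]
  exact Submodule.sum_mem _ fun σ hσ => Submodule.smul_mem _ _
    (Finsupp.single_mem_supported _ _ (hz hσ))

/-- The weights of `σ` and `σ \ v` differ by the factor `r v`, which the twist absorbs. -/
theorem rescale_twistedBoundary (r b : Fin n → R) (z : Finset (Fin n) →₀ R) :
    rescale r (twistedBoundary (r * b) z) = twistedBoundary b (rescale r z) := by
  induction z using Finsupp.induction_linear with
  | zero => simp
  | add x y hx hy => simp [hx, hy]
  | single σ c =>
    rw [rescale_single, twistedBoundary_single, twistedBoundary_single, map_sum]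
    refine Finset.sum_congr rfl fun v hv => ?_
    rw [rescale_single, ← Finset.mul_prod_erase σ r hv]
    congr 1
    simp; ring

theorem rescale_rescale (r s : Fin n → R) (h : r * s = 1) (z : Finset (Fin n) →₀ R) :
    rescale r (rescale s z) = z := by
  induction z using Finsupp.induction_linear with
  | zero => simp
  | add x y hx hy => simp [hx, hy]
  | single σ c =>
    rw [rescale_single, rescale_single, mul_assoc, ← Finset.prod_mul_distrib,
      Finset.prod_eq_one, mul_one]
    intro v _
    rw [mul_comm]; exact congrFun h v

/-! ### Exactness of twisted complexes. -/

/-- Every `twistedBoundary a`-cycle supported on `P` is the boundary of a chain supported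
on `Q`. -/
def ExactAt (a : Fin n → R) (P Q : Set (Finset (Fin n))) : Prop :=
  ∀ z ∈ Finsupp.supported R R P, twistedBoundary a z = 0 →
    ∃ y ∈ Finsupp.supported R R Q, twistedBoundary a y = z

theorem ExactAt.rescale {a b : Fin n → R} {P Q : Set (Finset (Fin n))} (h : ExactAt a P Q)
    (r s : Fin n → R) (hrs : r * s = 1) (hr : r * b = a) : ExactAt b P Q := by
  intro z hz h0
  have hs : s * a = b := by rw [← hr, ← mul_assoc, mul_comm s r, hrs, one_mul]
  obtain ⟨y, hy, e⟩ := h (Resonance.rescale s z) (rescale_mem hz) (by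
    rw [← rescale_twistedBoundary, hs, h0, map_zero])
  refine ⟨Resonance.rescale r y, rescale_mem hy, ?_⟩
  rw [← rescale_twistedBoundary, hr, e, rescale_rescale r s hrs]

theorem ExactAt.smul {a : Fin n → R} {P Q : Set (Finset (Fin n))} {t s : R} (hts : t * s = 1)
    (h : ExactAt a P Q) : ExactAt (t • a) P Q := by
  intro z hz h0
  rw [twistedBoundary_smul] at h0
  obtain ⟨y, hy, e⟩ := h z hz (by
    rw [← one_smul R (twistedBoundary a z), ← hts, mul_comm, mul_smul, h0, smul_zero])
  exact ⟨s • y, Submodule.smul_mem _ _ hy, by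
    rw [map_smul, twistedBoundary_smul, smul_smul, mul_comm, hts, one_smul, e]⟩

theorem smul_eq_twistedBoundary_coneOp {a : Fin n → R} {z : Finset (Fin n) →₀ R}
    (hz : twistedBoundary a z = 0) (u : Fin n) :
    a u • z = twistedBoundary a (coneOp R u z) := by
  rw [twistedBoundary_coneOp, hz, map_zero, sub_zero]

end Twisted

/-! ### Monomials in the exterior Stanley–Reisner ring -/

section Monomials

variable (k : Type*) [Field k] {n : ℕ}

theorem extMonomial_eq_prod_sort (σ : Finset (Fin n)) :
    extMonomial k σ
      = ((σ.sort (· ≤ ·)).map fun v => ExteriorAlgebra.ι k (Pi.single v (1 : k))).prod := by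
  rw [extMonomial, ExteriorAlgebra.basis_apply_ofCard _ rfl, ExteriorAlgebra.ιMulti_family,
    ExteriorAlgebra.ιMulti_apply, ← Finset.listMap_orderEmbOfFin_finRange σ rfl, List.map_map,
    List.ofFn_eq_map]
  congr 1
  refine List.map_congr_left fun i _ => ?_
  simp only [Function.comp_apply, Pi.basisFun_apply]
  rfl

theorem extMonomial_empty : extMonomial k (∅ : Finset (Fin n)) = 1 := by
  simp [extMonomial_eq_prod_sort]

theorem extMonomial_insert {v : Fin n} {τ : Finset (Fin n)} (h : ∀ w ∈ τ, v < w) :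
    extMonomial k (insert v τ) = ExteriorAlgebra.ι k (Pi.single v (1 : k)) * extMonomial k τ := by
  rw [extMonomial_eq_prod_sort, extMonomial_eq_prod_sort,
    Finset.sort_insert _ (fun w hw => (h w hw).le) fun hv => (h v hv).false, List.map_cons,
    List.prod_cons]

theorem ι_mul_ι_swap (a b : Fin n → k) :
    (ExteriorAlgebra.ι k a * ExteriorAlgebra.ι k b : Ext k n)
      = -(ExteriorAlgebra.ι k b * ExteriorAlgebra.ι k a) := by
  rw [eq_neg_iff_add_eq_zero]
  exact ExteriorAlgebra.ι_add_mul_swap a b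

/-- Induction peels off the smallest vertex `m`: moving `e_v` past `e_m` when `m < v` contributes
exactly one sign of `vertexSign`. -/
theorem ι_single_mul_extMonomial (v : Fin n) (σ : Finset (Fin n)) :
    ExteriorAlgebra.ι k (Pi.single v (1 : k)) * extMonomial k σ
      = if v ∈ σ then 0 else vertexSign k σ v • extMonomial k (insert v σ) := by
  induction σ using Finset.induction_on_min with
  | empty =>
    rw [if_neg (Finset.notMem_empty v), extMonomial_insert k (by simp)]
    simp [vertexSign]
  | insert m τ hm ih =>
    have hmτ : m ∉ τ := fun h => (hm m h).false
    rw [extMonomial_insert k hm, ← mul_assoc]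
    rcases lt_trichotomy v m with h | rfl | h
    · have hlt : ∀ w ∈ insert m τ, v < w := by
        intro w hw
        rcases Finset.mem_insert.mp hw with rfl | hw
        · exact h
        · exact h.trans (hm w hw)
      rw [if_neg (fun hv => (hlt v hv).false), extMonomial_insert k hlt, extMonomial_insert k hm,
        vertexSign, Finset.filter_eq_empty_iff.mpr fun w hw => (hlt w hw).not_gt]
      simp [mul_assoc]
    · simp
    · rw [ι_mul_ι_swap, neg_mul, mul_assoc, ih]
      by_cases hv : v ∈ τ
      · simp [hv]
      · have hlt : ∀ w ∈ insert v τ, m < w := by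
          intro w hw
          rcases Finset.mem_insert.mp hw with rfl | hw
          · exact h
          · exact hm w hw
        rw [if_neg hv, if_neg (by simp [hv, h.ne']), Finset.insert_comm, extMonomial_insert k hlt,
          vertexSign_insert_of_lt hmτ h, mul_smul_comm, neg_smul]

theorem extMonomial_mul (σ τ : Finset (Fin n)) :
    ∃ c : k, extMonomial k σ * extMonomial k τ = c • extMonomial k (σ ∪ τ) := by
  induction σ using Finset.induction_on_min with
  | empty => exact ⟨1, by simp [extMonomial_empty]⟩
  | insert m ρ hm ih =>
    obtain ⟨c, hc⟩ := ih
    rw [extMonomial_insert k hm, mul_assoc, hc, mul_smul_comm, ι_single_mul_extMonomial]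
    split_ifs
    · exact ⟨0, by simp⟩
    · exact ⟨c * vertexSign k (ρ ∪ τ) m, by rw [Finset.insert_union, smul_smul]⟩

variable (Δ : AbstractSimplicialComplex (Fin n))

/-- The span of the monomials of the non-faces. -/
def nonFaceSpan : Submodule k (Ext k n) :=
  Submodule.span k (extMonomial k '' {σ | σ.Nonempty ∧ σ ∉ Δ})

theorem nonface_mono {σ τ : Finset (Fin n)} (h : σ.Nonempty ∧ σ ∉ Δ) (hst : σ ⊆ τ) :
    τ.Nonempty ∧ τ ∉ Δ :=
  ⟨h.1.mono hst, fun hτ => h.2 ((Δ.isRelLowerSet_faces hτ).2 hst h.1)⟩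

theorem span_extMonomial : Submodule.span k (Set.range (extMonomial k (n := n))) = ⊤ :=
  (Pi.basisFun k (Fin n)).ExteriorAlgebra.span_eq

/-- Supersets of non-faces are non-faces and a product of monomials is a multiple of the monomial of
the union, so the linear span is already a two-sided ideal. -/
theorem mul_mem_nonFaceSpan (x : Ext k n) {y : Ext k n} (hy : y ∈ nonFaceSpan k Δ) :
    x * y ∈ nonFaceSpan k Δ ∧ y * x ∈ nonFaceSpan k Δ := by
  have hx : x ∈ Submodule.span k (Set.range (extMonomial k (n := n))) := by
    rw [span_extMonomial]; trivial
  induction hx using Submodule.span_induction with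
  | zero => simp
  | add x₁ x₂ _ _ h₁ h₂ =>
    rw [add_mul, mul_add]; exact ⟨add_mem h₁.1 h₂.1, add_mem h₁.2 h₂.2⟩
  | smul c x _ h =>
    rw [smul_mul_assoc, mul_smul_comm]
    exact ⟨Submodule.smul_mem _ _ h.1, Submodule.smul_mem _ _ h.2⟩
  | mem x hx =>
    obtain ⟨τ, rfl⟩ := hx
    induction hy using Submodule.span_induction with
    | zero => simp
    | add x₁ x₂ _ _ h₁ h₂ =>
      rw [add_mul, mul_add]; exact ⟨add_mem h₁.1 h₂.1, add_mem h₁.2 h₂.2⟩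
    | smul c x _ h =>
      rw [smul_mul_assoc, mul_smul_comm]
      exact ⟨Submodule.smul_mem _ _ h.1, Submodule.smul_mem _ _ h.2⟩
    | mem y hy =>
      obtain ⟨σ, hσ, rfl⟩ := hy
      obtain ⟨c, hc⟩ := extMonomial_mul k τ σ
      obtain ⟨c', hc'⟩ := extMonomial_mul k σ τ
      rw [hc, hc']
      exact ⟨Submodule.smul_mem _ _ (Submodule.subset_span
          ⟨_, nonface_mono Δ hσ Finset.subset_union_right, rfl⟩),
        Submodule.smul_mem _ _ (Submodule.subset_span
          ⟨_, nonface_mono Δ hσ Finset.subset_union_left, rfl⟩)⟩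

/-- The two-sided ideal spanned by the monomials of the non-faces. -/
def nonFaceIdeal : Ideal (Ext k n) where
  carrier := nonFaceSpan k Δ
  add_mem' := add_mem
  zero_mem' := zero_mem _
  smul_mem' x _ hy := (mul_mem_nonFaceSpan k Δ x hy).1

instance : (nonFaceIdeal k Δ).IsTwoSided where
  mul_mem_of_left x hy := (mul_mem_nonFaceSpan k Δ x hy).2

/-- The quotient by `nonFaceIdeal` satisfies the defining relations, so it factors through `k⟨Δ⟩`;
this bounds the kernel from above. -/
theorem mem_nonFaceSpan_of_mkExtSR_eq_zero {x : Ext k n} (hx : mkExtSR k Δ x = 0) :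
    x ∈ nonFaceSpan k Δ := by
  let f : Ext k n →ₐ[k] Ext k n ⧸ nonFaceIdeal k Δ := Ideal.Quotient.mkₐ k (nonFaceIdeal k Δ)
  have hf : ∀ ⦃x y⦄, nonFaceRel k Δ x y → f x = f y := by
    rintro _ _ ⟨σ, h₁, h₂, rfl, rfl⟩
    rw [map_zero]
    exact Ideal.Quotient.eq_zero_iff_mem.mpr (Submodule.subset_span ⟨σ, ⟨h₁, h₂⟩, rfl⟩)
  have h := RingQuot.liftAlgHom_mkAlgHom_apply k f hf x
  have h0 : RingQuot.mkAlgHom k (nonFaceRel k Δ) x = 0 := hx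
  rw [h0, map_zero] at h
  exact Ideal.Quotient.eq_zero_iff_mem.mp h.symm

/-- The simplices with `i` vertices, including the empty one. -/
def simplices (i : ℕ) : Set (Finset (Fin n)) := {σ | (σ = ∅ ∨ σ ∈ Δ) ∧ σ.card = i}

theorem mkExtSR_extMonomial_of_notMem {i : ℕ} {σ : Finset (Fin n)} (hc : σ.card = i)
    (h : σ ∉ simplices Δ i) : mkExtSR k Δ (extMonomial k σ) = 0 := by
  have : σ ≠ ∅ ∧ σ ∉ Δ := not_or.mp fun h' => h ⟨h', hc⟩
  have := RingQuot.mkAlgHom_rel k (s := nonFaceRel k Δ)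
    ⟨σ, Finset.nonempty_iff_ne_empty.mpr this.1, this.2, rfl, rfl⟩
  rw [map_zero] at this
  exact this

theorem extMonomial_mem_exteriorPower (σ : Finset (Fin n)) :
    extMonomial k σ ∈ ⋀[k]^σ.card (Fin n → k) := by
  rw [extMonomial, ExteriorAlgebra.basis_apply_ofCard _ rfl]
  exact Subtype.property (exteriorPower.ιMulti_family k _ _ _)

theorem exteriorPower_le_span (i : ℕ) :
    (⋀[k]^i (Fin n → k)) ≤ Submodule.span k (extMonomial k '' {σ | σ.card = i}) := by
  intro x hx
  have h : (⟨x, hx⟩ : ⋀[k]^i (Fin n → k))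
      ∈ Submodule.span k (Set.range ((Pi.basisFun k (Fin n)).exteriorPower i)) := by
    rw [Module.Basis.span_eq]; trivial
  have := Submodule.mem_map_of_mem (f := Submodule.subtype _) h
  rw [Submodule.map_span, ← Set.range_comp] at this
  refine Submodule.span_mono ?_ this
  rintro _ ⟨s, rfl⟩
  exact ⟨s, s.2, ExteriorAlgebra.basis_eq_coe_basis _ s⟩

theorem mkExtSR_extMonomial_mem_deg {i : ℕ} {σ : Finset (Fin n)} (hσ : σ.card = i) :
    mkExtSR k Δ (extMonomial k σ) ∈ deg k Δ i :=
  ⟨_, hσ ▸ extMonomial_mem_exteriorPower k σ, rfl⟩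

/-- The class of the monomial `e_σ` in `A^i`. -/
def degMonomial (i : ℕ) (σ : Finset (Fin n)) : deg k Δ i :=
  if h : σ.card = i then ⟨_, mkExtSR_extMonomial_mem_deg k Δ h⟩ else 0

theorem coe_degMonomial {i : ℕ} {σ : Finset (Fin n)} (hσ : σ.card = i) :
    (degMonomial k Δ i σ : ExtSR k Δ) = mkExtSR k Δ (extMonomial k σ) := by
  rw [degMonomial, dif_pos hσ]

theorem degMonomial_eq_zero {i : ℕ} {σ : Finset (Fin n)} (hσ : σ ∉ simplices Δ i) :
    degMonomial k Δ i σ = 0 := by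
  by_cases h : σ.card = i
  · exact Subtype.ext ((coe_degMonomial k Δ h).trans (mkExtSR_extMonomial_of_notMem k Δ h hσ))
  · rw [degMonomial, dif_neg h]

theorem linearIndependent_degMonomial (i : ℕ) :
    LinearIndependent k fun σ : simplices Δ i => degMonomial k Δ i σ := by
  rw [linearIndependent_iff]
  intro l hl
  let b := (Pi.basisFun k (Fin n)).ExteriorAlgebra
  have hx : mkExtSR k Δ (Finsupp.linearCombination k b (l.mapDomain Subtype.val)) = 0 := by
    have := congrArg Subtype.val hl
    rw [Finsupp.linearCombination_apply, Finsupp.sum, Submodule.coe_sum] at this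
    rw [Finsupp.linearCombination_mapDomain, Finsupp.linearCombination_apply, Finsupp.sum, map_sum]
    refine Eq.trans (Finset.sum_congr rfl fun σ _ => ?_) this
    rw [map_smul, Submodule.coe_smul, coe_degMonomial k Δ σ.2.2]
    rfl
  -- A relation among faces is a combination of non-faces in the monomial basis of `E`; the two
  -- index sets are disjoint, so it is trivial.
  have hs := mem_nonFaceSpan_of_mkExtSR_eq_zero k Δ hx
  have hs' : l.mapDomain Subtype.val ∈ Finsupp.supported k k {σ | σ.Nonempty ∧ σ ∉ Δ} := by
    have := b.mem_span_image.mp hs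
    rwa [b.repr_linearCombination] at this
  ext σ
  rw [← Finsupp.mapDomain_apply Subtype.val_injective l σ]
  refine (Finsupp.mem_supported' _ _).mp hs' σ ?_
  rintro ⟨h₁, h₂⟩
  rcases σ.2.1 with h | h
  · exact h₁.ne_empty h
  · exact h₂ h

theorem span_degMonomial (i : ℕ) :
    ⊤ ≤ Submodule.span k (Set.range fun σ : simplices Δ i => degMonomial k Δ i σ) := by
  rintro ⟨y, hy⟩ -
  obtain ⟨x, hx, rfl⟩ := id hy
  have : ∀ y ∈ Submodule.span k (extMonomial k '' {σ : Finset (Fin n) | σ.card = i}),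
      ∃ z ∈ Submodule.span k (Set.range fun σ : simplices Δ i => degMonomial k Δ i σ),
        (z : ExtSR k Δ) = mkExtSR k Δ y := by
    intro y hy
    induction hy using Submodule.span_induction with
    | zero => exact ⟨0, zero_mem _, by simp⟩
    | add x y _ _ hx hy =>
      obtain ⟨z, hz, e⟩ := hx
      obtain ⟨w, hw, e'⟩ := hy
      exact ⟨z + w, add_mem hz hw, by simp [e, e']⟩
    | smul c x _ hx =>
      obtain ⟨z, hz, e⟩ := hx
      exact ⟨c • z, Submodule.smul_mem _ _ hz, by simp [e]⟩
    | mem x hx =>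
      obtain ⟨σ, hσ, rfl⟩ := hx
      by_cases h : σ ∈ simplices Δ i
      · exact ⟨_, Submodule.subset_span ⟨⟨σ, h⟩, rfl⟩, coe_degMonomial k Δ hσ⟩
      · exact ⟨0, zero_mem _, by rw [mkExtSR_extMonomial_of_notMem k Δ hσ h]; rfl⟩
  obtain ⟨z, hz, e⟩ := this x (exteriorPower_le_span k i hx)
  rwa [show (⟨_, hy⟩ : deg k Δ i) = z from Subtype.ext e.symm]

/-- The monomial basis of `A^i`. -/
def degBasis (i : ℕ) : Module.Basis (simplices Δ i) k (deg k Δ i) :=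
  Module.Basis.mk (linearIndependent_degMonomial k Δ i) (span_degMonomial k Δ i)

theorem degBasis_apply (i : ℕ) (σ : simplices Δ i) : degBasis k Δ i σ = degMonomial k Δ i σ := by
  simp [degBasis]

theorem delta_single_degMonomial (v : Fin n) {i : ℕ} {σ : Finset (Fin n)} (hσ : σ.card = i) :
    delta k Δ (Pi.single v 1) i (degMonomial k Δ i σ)
      = if v ∈ σ then 0 else vertexSign k σ v • degMonomial k Δ (i + 1) (insert v σ) := by
  apply Subtype.ext
  have : (delta k Δ (Pi.single v 1) i (degMonomial k Δ i σ) : ExtSR k Δ)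
      = mkExtSR k Δ (ExteriorAlgebra.ι k (Pi.single v (1 : k)) * extMonomial k σ) := by
    rw [map_mul, ← coe_degMonomial k Δ hσ]; rfl
  rw [this, ι_single_mul_extMonomial]
  split_ifs with h
  · simp
  · rw [map_smul, Submodule.coe_smul, coe_degMonomial]
    rw [Finset.card_insert_of_notMem h, hσ]

theorem delta_eq_sum (a : Fin n → k) (i : ℕ) :
    delta k Δ a i = ∑ v, a v • delta k Δ (Pi.single v 1) i := by
  have ha : a = ∑ v, a v • Pi.single v (1 : k) := by
    ext w; simp [Finset.sum_apply, Pi.single_apply]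
  ext u
  conv_lhs => rw [ha]
  simp [delta, Finset.sum_mul]

end Monomials

/-! ### Resonance loci in terms of twisted boundaries -/

section Bridge

theorem nontrivial_subquotient_iff {R M : Type*} [Ring R] [AddCommGroup M] [Module R M]
    {Z B : Submodule R M} : Nontrivial (Subquotient Z B) ↔ ¬ Z ≤ B := by
  rw [Submodule.Quotient.nontrivial_iff, ne_eq, Submodule.submoduleOf, Submodule.comap_subtype_eq_top]

theorem mem_annihilator_subquotient_iff {R M : Type*} [CommRing R] [AddCommGroup M] [Module R M]
    {Z B : Submodule R M} {f : R} :
    f ∈ Module.annihilator R (Subquotient Z B) ↔ ∀ z ∈ Z, f • z ∈ B := by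
  rw [Module.mem_annihilator]
  constructor
  · intro h z hz
    have := h (Submodule.Quotient.mk ⟨z, hz⟩)
    rwa [← Submodule.Quotient.mk_smul, Submodule.Quotient.mk_eq_zero] at this
  · intro h m
    obtain ⟨z, rfl⟩ := Submodule.Quotient.mk_surjective _ m
    rw [← Submodule.Quotient.mk_smul, Submodule.Quotient.mk_eq_zero]
    exact h z z.2

/-- Read coefficientwise, the boundary sums over the vertices that can be added to `ρ`, as
multiplication by `a` does on `e_ρ`; this makes the duality visible. -/
theorem twistedBoundary_apply {R : Type*} [CommRing R] {n : ℕ} (a : Fin n → R)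
    (z : Finset (Fin n) →₀ R) (ρ : Finset (Fin n)) :
    twistedBoundary a z ρ
      = ∑ v, if v ∈ ρ then 0 else a v * (vertexSign R ρ v * z (insert v ρ)) := by
  induction z using Finsupp.induction_linear with
  | zero => simp
  | add x y hx hy =>
    rw [map_add, Finsupp.add_apply, hx, hy, ← Finset.sum_add_distrib]
    refine Finset.sum_congr rfl fun v _ => ?_
    split_ifs
    · simp
    · rw [Finsupp.add_apply]; ring
  | single σ c =>
    rw [twistedBoundary_single, Finsupp.finsetSum_apply, ← Finset.sum_subset (Finset.subset_univ σ)]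
    · refine Finset.sum_congr rfl fun v hv => ?_
      by_cases hρ : v ∈ ρ
      · rw [if_pos hρ, Finsupp.single_eq_of_ne]
        rintro rfl
        exact Finset.notMem_erase v σ hρ
      · rw [if_neg hρ]
        by_cases h : σ.erase v = ρ
        · subst h
          rw [Finset.insert_erase hv, Finsupp.single_eq_same, Finsupp.single_eq_same,
            vertexSign_erase_self]
          ring
        · rw [Finsupp.single_eq_of_ne (Ne.symm h), Finsupp.single_eq_of_ne]
          · simp
          · rintro rfl
            exact h (Finset.erase_insert hρ)
    · intro v _ hv
      split_ifs with h
      · rfl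
      · rw [Finsupp.single_eq_of_ne]
        · simp
        · rintro rfl
          exact hv (Finset.mem_insert_self v ρ)

variable (k : Type*) [Field k] {n : ℕ} (Δ : AbstractSimplicialComplex (Fin n))

theorem dual_ext {i : ℕ} {φ ψ : Module.Dual k (deg k Δ i)}
    (h : ∀ σ ∈ simplices Δ i, φ (degMonomial k Δ i σ) = ψ (degMonomial k Δ i σ)) : φ = ψ :=
  (degBasis k Δ i).ext fun σ => by simpa only [degBasis_apply] using h σ σ.2

open Classical in
/-- The coordinate functional `e_σ^*` on `A^i`, zero if `σ` is not a simplex with `i` vertices. -/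
def dualCoord (i : ℕ) (σ : Finset (Fin n)) : Module.Dual k (deg k Δ i) :=
  if h : σ ∈ simplices Δ i then (degBasis k Δ i).coord ⟨σ, h⟩ else 0

open Classical in
theorem dualCoord_degMonomial {i : ℕ} {σ : Finset (Fin n)} (hσ : σ ∈ simplices Δ i)
    (ρ : Finset (Fin n)) : dualCoord k Δ i σ (degMonomial k Δ i ρ) = Finsupp.single σ 1 ρ := by
  by_cases hρ : ρ ∈ simplices Δ i
  · have h := degBasis_apply k Δ i ⟨ρ, hρ⟩
    rw [dualCoord, dif_pos hσ, ← h, Module.Basis.coord_apply, Module.Basis.repr_self,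
      Finsupp.single_apply, Finsupp.single_apply]
    simp [eq_comm]
  · rw [degMonomial_eq_zero k Δ hρ, map_zero, Finsupp.single_eq_of_ne]
    rintro rfl
    exact hρ hσ

theorem dualCoord_eq_zero {i : ℕ} {σ : Finset (Fin n)} (hσ : σ ∉ simplices Δ i) :
    dualCoord k Δ i σ = 0 := dif_neg hσ

theorem sum_smul_dualCoord {i : ℕ} (φ : Module.Dual k (deg k Δ i)) :
    ∑ σ, φ (degMonomial k Δ i σ) • dualCoord k Δ i σ = φ := by
  refine dual_ext k Δ fun ρ hρ => ?_
  rw [LinearMap.sum_apply, Finset.sum_eq_single ρ]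
  · simp [dualCoord_degMonomial k Δ hρ]
  · intro σ _ h
    by_cases hσ : σ ∈ simplices Δ i
    · simp [dualCoord_degMonomial k Δ hσ, h]
    · simp [dualCoord_eq_zero k Δ hσ]
  · simp

theorem delta_degMonomial (a : Fin n → k) {i : ℕ} {ρ : Finset (Fin n)} (hρ : ρ.card = i) :
    delta k Δ a i (degMonomial k Δ i ρ)
      = ∑ v, if v ∈ ρ then 0 else
        a v • vertexSign k ρ v • degMonomial k Δ (i + 1) (insert v ρ) := by
  rw [delta_eq_sum, LinearMap.sum_apply]
  refine Finset.sum_congr rfl fun v _ => ?_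
  rw [LinearMap.smul_apply, delta_single_degMonomial k Δ v hρ]
  split_ifs <;> simp

theorem insert_notMem_simplices {i : ℕ} {ρ : Finset (Fin n)} (hρ : ρ.card ≠ i) {v : Fin n}
    (hv : v ∉ ρ) : insert v ρ ∉ simplices Δ (i + 1) := fun h => hρ <| by
  have := h.2
  rwa [Finset.card_insert_of_notMem hv, Nat.add_right_cancel_iff] at this

/-- The chain `∑_σ φ(e_σ) [σ]` of a functional `φ` on `A^i`. -/
def dualChain (i : ℕ) : Module.Dual k (deg k Δ i) →ₗ[k] (Finset (Fin n) →₀ k) where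
  toFun φ := Finsupp.equivFunOnFinite.symm fun σ => φ (degMonomial k Δ i σ)
  map_add' _ _ := by ext; simp
  map_smul' _ _ := by ext; simp

theorem dualChain_apply {i : ℕ} (φ : Module.Dual k (deg k Δ i)) (σ : Finset (Fin n)) :
    dualChain k Δ i φ σ = φ (degMonomial k Δ i σ) := rfl

theorem dualChain_injective (i : ℕ) : Function.Injective (dualChain k Δ i) := fun _ _ h =>
  dual_ext k Δ fun σ _ => DFunLike.congr_fun h σ

theorem dualChain_mem {i : ℕ} (φ : Module.Dual k (deg k Δ i)) :
    dualChain k Δ i φ ∈ Finsupp.supported k k (simplices Δ i) :=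
  (Finsupp.mem_supported' _ _).mpr fun σ hσ => by
    rw [dualChain_apply, degMonomial_eq_zero k Δ hσ, map_zero]

theorem exists_dualChain_eq {i : ℕ} {z : Finset (Fin n) →₀ k}
    (hz : z ∈ Finsupp.supported k k (simplices Δ i)) : ∃ φ, dualChain k Δ i φ = z := by
  refine ⟨∑ σ, z σ • dualCoord k Δ i σ, ?_⟩
  ext ρ
  rw [dualChain_apply, LinearMap.sum_apply, Finset.sum_eq_single ρ]
  · by_cases hρ : ρ ∈ simplices Δ i
    · simp [dualCoord_degMonomial k Δ hρ]
    · simp [dualCoord_eq_zero k Δ hρ, (Finsupp.mem_supported' _ _).mp hz ρ hρ]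
  · intro σ _ h
    by_cases hσ : σ ∈ simplices Δ i
    · simp [dualCoord_degMonomial k Δ hσ, h]
    · simp [dualCoord_eq_zero k Δ hσ]
  · simp

theorem dualChain_dualMap (a : Fin n → k) {i : ℕ} (φ : Module.Dual k (deg k Δ (i + 1))) :
    dualChain k Δ i ((delta k Δ a i).dualMap φ) = twistedBoundary a (dualChain k Δ (i + 1) φ) := by
  ext ρ
  rw [dualChain_apply, LinearMap.dualMap_apply, twistedBoundary_apply]
  by_cases hρ : ρ.card = i
  · rw [delta_degMonomial k Δ a hρ, map_sum]
    refine Finset.sum_congr rfl fun v _ => ?_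
    split_ifs
    · simp
    · simp [dualChain_apply]
  · rw [degMonomial_eq_zero k Δ fun h => hρ h.2, map_zero, map_zero]
    refine (Finset.sum_eq_zero fun v _ => ?_).symm
    split_ifs with hv
    · rfl
    · rw [dualChain_apply, degMonomial_eq_zero k Δ (insert_notMem_simplices Δ hρ hv)]
      simp

/-- Only `∅` has no vertices. This matches the conventions `A^{-1} = 0` and `A_{-1} = 0`. -/
theorem twistedBoundary_eq_zero_of_simplices_zero {R : Type*} [CommRing R] (a : Fin n → R)
    {z : Finset (Fin n) →₀ R} (hz : z ∈ Finsupp.supported R R (simplices Δ 0)) :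
    twistedBoundary a z = 0 := by
  have := twistedBoundary_mem (a := a) (Q := ∅) (fun σ hσ v hv => by
    rw [Finset.card_eq_zero.mp hσ.2] at hv; simp at hv) hz
  simpa using this

theorem dualAnnihilator_coboundaries (a : Fin n → k) {i : ℕ} (φ : Module.Dual k (deg k Δ i)) :
    φ ∈ (coboundaries k Δ a i).dualAnnihilator ↔ twistedBoundary a (dualChain k Δ i φ) = 0 := by
  cases i with
  | zero =>
    have := twistedBoundary_eq_zero_of_simplices_zero Δ a (dualChain_mem k Δ φ)
    simp [coboundaries, this]
  | succ i =>
    rw [coboundaries, ← LinearMap.ker_dualMap_eq_dualAnnihilator_range, LinearMap.mem_ker,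
      ← dualChain_dualMap, map_eq_zero_iff _ (dualChain_injective k Δ i)]

/-- The jump resonance locus in terms of chains. -/
theorem mem_jumpResonance_iff (a : Fin n → k) (i : ℕ) :
    a ∈ jumpResonance k Δ i ↔ ¬ ExactAt a (simplices Δ i) (simplices Δ (i + 1)) := by
  rw [jumpResonance, Set.mem_ofPred_eq, nontrivial_subquotient_iff, not_iff_not,
    -- Passing to annihilators reverses `ker ≤ im`: cycles of the dual complex annihilate
    -- coboundaries, and boundaries are what annihilates cocycles.
    ← Subspace.dualAnnihilator_le_dualAnnihilator_iff,
    ← LinearMap.range_dualMap_eq_dualAnnihilator_ker]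
  constructor
  · intro h z hz h0
    obtain ⟨φ, rfl⟩ := exists_dualChain_eq k Δ hz
    obtain ⟨ψ, rfl⟩ := h ((dualAnnihilator_coboundaries k Δ a φ).mpr h0)
    exact ⟨_, dualChain_mem k Δ ψ, (dualChain_dualMap k Δ a ψ).symm⟩
  · intro h φ hφ
    obtain ⟨y, hy, e⟩ := h _ (dualChain_mem k Δ φ) ((dualAnnihilator_coboundaries k Δ a φ).mp hφ)
    obtain ⟨ψ, rfl⟩ := exists_dualChain_eq k Δ hy
    exact ⟨ψ, dualChain_injective k Δ i ((dualChain_dualMap k Δ a ψ).trans e)⟩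

/-- Evaluation of the dual factor of `A_i ⊗ S` at the monomial `e_σ`. -/
def koszulCoeff (i : ℕ) (σ : Finset (Fin n)) :
    KoszulTerm k Δ i →ₗ[MvPolynomial (Fin n) k] MvPolynomial (Fin n) k :=
  Module.Dual.baseChange (MvPolynomial (Fin n) k)
    (Module.Dual.eval k (deg k Δ i) (degMonomial k Δ i σ))

theorem koszulCoeff_tmul {i : ℕ} (σ : Finset (Fin n)) (s : MvPolynomial (Fin n) k)
    (φ : Module.Dual k (deg k Δ i)) :
    koszulCoeff k Δ i σ (s ⊗ₜ φ) = φ (degMonomial k Δ i σ) • s := by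
  simp [koszulCoeff]

/-- The identification of `A_i ⊗ S` with chains over `S`. -/
def koszulChain (i : ℕ) :
    KoszulTerm k Δ i →ₗ[MvPolynomial (Fin n) k] (Finset (Fin n) →₀ MvPolynomial (Fin n) k) where
  toFun t := Finsupp.equivFunOnFinite.symm fun σ => koszulCoeff k Δ i σ t
  map_add' _ _ := by ext1; simp
  map_smul' _ _ := by ext1; simp

theorem koszulChain_apply {i : ℕ} (t : KoszulTerm k Δ i) (σ : Finset (Fin n)) :
    koszulChain k Δ i t σ = koszulCoeff k Δ i σ t := rfl

/-- The element `∑_σ z_σ ⊗ e_σ^*` of `A_i ⊗ S` given by a chain `z`. -/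
def chainKoszul (i : ℕ) (z : Finset (Fin n) →₀ MvPolynomial (Fin n) k) : KoszulTerm k Δ i :=
  ∑ σ, z σ ⊗ₜ dualCoord k Δ i σ

theorem chainKoszul_koszulChain {i : ℕ} (t : KoszulTerm k Δ i) :
    chainKoszul k Δ i (koszulChain k Δ i t) = t := by
  induction t using TensorProduct.induction_on with
  | zero => simp [chainKoszul]
  | add x y hx hy =>
    conv_rhs => rw [← hx, ← hy]
    simp only [chainKoszul, map_add, Finsupp.add_apply, TensorProduct.add_tmul,
      Finset.sum_add_distrib]
  | tmul s φ =>
    conv_rhs => rw [← sum_smul_dualCoord k Δ φ, TensorProduct.tmul_sum]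
    refine Finset.sum_congr rfl fun σ _ => ?_
    rw [koszulChain_apply, koszulCoeff_tmul, TensorProduct.smul_tmul]

theorem koszulChain_injective (i : ℕ) : Function.Injective (koszulChain k Δ i) :=
  Function.LeftInverse.injective (chainKoszul_koszulChain k Δ)

theorem koszulCoeff_eq_zero {i : ℕ} {σ : Finset (Fin n)} (hσ : σ ∉ simplices Δ i) :
    koszulCoeff k Δ i σ = 0 := by
  simp [koszulCoeff, degMonomial_eq_zero k Δ hσ]

theorem koszulChain_mem {i : ℕ} (t : KoszulTerm k Δ i) :
    koszulChain k Δ i t ∈ Finsupp.supported _ (MvPolynomial (Fin n) k) (simplices Δ i) :=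
  (Finsupp.mem_supported' _ _).mpr fun σ hσ => by
    rw [koszulChain_apply, koszulCoeff_eq_zero k Δ hσ, LinearMap.zero_apply]

theorem exists_koszulChain_eq {i : ℕ} {z : Finset (Fin n) →₀ MvPolynomial (Fin n) k}
    (hz : z ∈ Finsupp.supported _ (MvPolynomial (Fin n) k) (simplices Δ i)) :
    ∃ t, koszulChain k Δ i t = z := by
  refine ⟨chainKoszul k Δ i z, ?_⟩
  ext1 ρ
  rw [koszulChain_apply, chainKoszul, map_sum, Finset.sum_eq_single ρ]
  · rw [koszulCoeff_tmul]
    by_cases hρ : ρ ∈ simplices Δ i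
    · simp [dualCoord_degMonomial k Δ hρ]
    · simp [dualCoord_eq_zero k Δ hρ, (Finsupp.mem_supported' _ _).mp hz ρ hρ]
  · intro σ _ h
    rw [koszulCoeff_tmul]
    by_cases hσ : σ ∈ simplices Δ i
    · simp [dualCoord_degMonomial k Δ hσ, h]
    · simp [dualCoord_eq_zero k Δ hσ]
  · simp

theorem koszulChain_koszulDiff {i : ℕ} (t : KoszulTerm k Δ (i + 1)) :
    koszulChain k Δ i (koszulDiff k Δ i t)
      = twistedBoundary MvPolynomial.X (koszulChain k Δ (i + 1) t) := by
  induction t using TensorProduct.induction_on with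
  | zero => simp
  | add x y hx hy => simp only [map_add, hx, hy]
  | tmul s φ =>
    ext1 ρ
    rw [koszulChain_apply, twistedBoundary_apply, koszulDiff, LinearMap.sum_apply, map_sum]
    refine Finset.sum_congr rfl fun v _ => ?_
    rw [LinearMap.smul_apply, map_smul, LinearMap.baseChange_tmul, koszulCoeff_tmul,
      koszulChain_apply, koszulCoeff_tmul, LinearMap.dualMap_apply]
    by_cases hρ : ρ.card = i
    · rw [delta_single_degMonomial k Δ v hρ]
      split_ifs
      · simp
      · simp [vertexSign, MvPolynomial.smul_eq_C_mul, mul_assoc]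
    · rw [degMonomial_eq_zero k Δ fun h => hρ h.2]
      split_ifs with hv
      · simp
      · rw [degMonomial_eq_zero k Δ (insert_notMem_simplices Δ hρ hv)]
        simp

theorem mem_koszulCycles_iff {i : ℕ} (t : KoszulTerm k Δ i) :
    t ∈ koszulCycles k Δ i ↔ twistedBoundary MvPolynomial.X (koszulChain k Δ i t) = 0 := by
  cases i with
  | zero =>
    have := twistedBoundary_eq_zero_of_simplices_zero Δ MvPolynomial.X (koszulChain_mem k Δ t)
    simp [koszulCycles, this]
  | succ i =>
    rw [koszulCycles, LinearMap.mem_ker, ← koszulChain_koszulDiff,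
      map_eq_zero_iff _ (koszulChain_injective k Δ i)]

/-- The annihilator of the Koszul module in terms of chains. -/
theorem mem_annihilator_koszulModule_iff {i : ℕ} (f : MvPolynomial (Fin n) k) :
    f ∈ Module.annihilator (MvPolynomial (Fin n) k) (KoszulModule k Δ i) ↔
      ∀ z ∈ Finsupp.supported (MvPolynomial (Fin n) k) (MvPolynomial (Fin n) k) (simplices Δ i),
        twistedBoundary MvPolynomial.X z = 0 →
          ∃ y ∈ Finsupp.supported (MvPolynomial (Fin n) k) (MvPolynomial (Fin n) k)
              (simplices Δ (i + 1)),
            twistedBoundary MvPolynomial.X y = f • z := by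
  rw [mem_annihilator_subquotient_iff]
  constructor
  · intro h z hz h0
    obtain ⟨t, rfl⟩ := exists_koszulChain_eq k Δ hz
    obtain ⟨w, hw⟩ := h t ((mem_koszulCycles_iff k Δ t).mpr h0)
    exact ⟨_, koszulChain_mem k Δ w, by rw [← koszulChain_koszulDiff, hw, map_smul]⟩
  · intro h t ht
    obtain ⟨y, hy, e⟩ := h _ (koszulChain_mem k Δ t) ((mem_koszulCycles_iff k Δ t).mp ht)
    obtain ⟨w, rfl⟩ := exists_koszulChain_eq k Δ hy
    exact ⟨w, koszulChain_injective k Δ i (by rw [koszulChain_koszulDiff, e, map_smul])⟩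

end Bridge

/-! ### Specialization of chains -/

section Specialization

variable {k : Type*} [Field k] {n : ℕ}

/-- Evaluation of the coefficients of a chain at a point. -/
def evalChain (a : Fin n → k) (z : Finset (Fin n) →₀ MvPolynomial (Fin n) k) :
    Finset (Fin n) →₀ k :=
  z.mapRange (MvPolynomial.eval a) (map_zero _)

/-- The chain over `S` with constant coefficients. -/
def constChain (z : Finset (Fin n) →₀ k) : Finset (Fin n) →₀ MvPolynomial (Fin n) k :=
  z.mapRange MvPolynomial.C (map_zero _)

theorem evalChain_apply (a : Fin n → k) (z : Finset (Fin n) →₀ MvPolynomial (Fin n) k)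
    (σ : Finset (Fin n)) : evalChain a z σ = MvPolynomial.eval a (z σ) := rfl

theorem evalChain_constChain (a : Fin n → k) (z : Finset (Fin n) →₀ k) :
    evalChain a (constChain z) = z := by
  ext σ; simp [evalChain, constChain]

theorem evalChain_smul (a : Fin n → k) (f : MvPolynomial (Fin n) k)
    (z : Finset (Fin n) →₀ MvPolynomial (Fin n) k) :
    evalChain a (f • z) = MvPolynomial.eval a f • evalChain a z := by
  ext σ; simp [evalChain]

theorem evalChain_sub (a : Fin n → k) (z w : Finset (Fin n) →₀ MvPolynomial (Fin n) k) :
    evalChain a (z - w) = evalChain a z - evalChain a w := by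
  ext σ; simp [evalChain]

theorem evalChain_twistedBoundary (a : Fin n → k)
    (z : Finset (Fin n) →₀ MvPolynomial (Fin n) k) :
    evalChain a (twistedBoundary MvPolynomial.X z) = twistedBoundary a (evalChain a z) := by
  have := mapRange_twistedBoundary (MvPolynomial.eval a) MvPolynomial.X z
  simp only [MvPolynomial.eval_X] at this
  exact this

theorem evalChain_mem {a : Fin n → k} {P : Set (Finset (Fin n))}
    {z : Finset (Fin n) →₀ MvPolynomial (Fin n) k}
    (hz : z ∈ Finsupp.supported (MvPolynomial (Fin n) k) (MvPolynomial (Fin n) k) P) :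
    evalChain a z ∈ Finsupp.supported k k P :=
  (Finsupp.mem_supported' _ _).mpr fun σ hσ => by
    rw [evalChain_apply, (Finsupp.mem_supported' _ _).mp hz σ hσ, map_zero]

theorem constChain_mem {P : Set (Finset (Fin n))} {z : Finset (Fin n) →₀ k}
    (hz : z ∈ Finsupp.supported k k P) :
    constChain z ∈ Finsupp.supported (MvPolynomial (Fin n) k) (MvPolynomial (Fin n) k) P :=
  (Finsupp.mem_supported' _ _).mpr fun σ hσ => by
    rw [constChain, Finsupp.mapRange_apply, (Finsupp.mem_supported' _ _).mp hz σ hσ, map_zero]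

theorem mem_supportResonance_iff (Δ : AbstractSimplicialComplex (Fin n)) (i : ℕ) (a : Fin n → k) :
    a ∈ supportResonance k Δ i ↔
      ∀ f ∈ Module.annihilator (MvPolynomial (Fin n) k) (KoszulModule k Δ i),
        MvPolynomial.eval a f = 0 := by
  rw [supportResonance, MvPolynomial.mem_zeroLocus_iff]
  rfl

/-- Restricted to a line, `f` is a one-variable polynomial with infinitely many roots. This is the
closure argument used for zero loci. -/
theorem eval_eq_zero_of_line [Infinite k] (f : MvPolynomial (Fin n) k) (a c : Fin n → k)
    {T : Set k} (hT : T.Finite) (h : ∀ t ∉ T, MvPolynomial.eval (a + t • c) f = 0) :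
    MvPolynomial.eval a f = 0 := by
  let p : Polynomial k :=
    MvPolynomial.aeval (fun v => Polynomial.C (a v) + Polynomial.C (c v) * Polynomial.X) f
  have hp : ∀ t, p.eval t = MvPolynomial.eval (a + t • c) f := by
    intro t
    have : (Polynomial.aeval t).comp (MvPolynomial.aeval
        (fun v => Polynomial.C (a v) + Polynomial.C (c v) * Polynomial.X))
        = MvPolynomial.aeval (a + t • c) := by
      ext v
      simp only [AlgHom.comp_apply, MvPolynomial.aeval_X, map_add, map_mul, Polynomial.aeval_C,
        Polynomial.aeval_X, Algebra.algebraMap_self, RingHom.id_apply, Pi.add_apply,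
        Pi.smul_apply, smul_eq_mul, mul_comm]
    have := DFunLike.congr_fun this f
    rw [AlgHom.comp_apply, Polynomial.coe_aeval_eq_eval] at this
    exact this
  have h0 : p = 0 := Polynomial.eq_zero_of_infinite_isRoot _ <|
    hT.infinite_compl.mono fun t ht => (hp t).trans (h t ht)
  have := hp 0
  rw [h0] at this
  simpa using this.symm

theorem ExactAt.of_unit {R : Type*} [CommRing R] {a : Fin n → R} {u : Fin n} {c : R}
    (hc : c * a u = 1) {P Q : Set (Finset (Fin n))} (h : ∀ σ ∈ P, u ∉ σ → insert u σ ∈ Q) :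
    ExactAt a P Q := fun z hz h0 =>
  ⟨c • coneOp R u z, Submodule.smul_mem _ _ (coneOp_mem h hz), by
    rw [map_smul, ← smul_eq_twistedBoundary_coneOp h0, smul_smul, hc, one_smul]⟩

theorem exactAt_card {a : Fin n → k} {u : Fin n} (hu : a u ≠ 0) (i : ℕ) :
    ExactAt a {σ | σ.card = i} {σ | σ.card = i + 1} :=
  ExactAt.of_unit (inv_mul_cancel₀ hu) fun σ hσ huσ => by
    change (insert u σ).card = i + 1
    rw [Finset.card_insert_of_notMem huσ, show σ.card = i from hσ]

theorem twistedBoundary_mem_card {R : Type*} [CommRing R] {a : Fin n → R} {i : ℕ}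
    {z : Finset (Fin n) →₀ R} (hz : z ∈ Finsupp.supported R R {σ | σ.card = i + 1}) :
    twistedBoundary a z ∈ Finsupp.supported R R {σ | σ.card = i} :=
  twistedBoundary_mem (fun σ hσ v hv => by
    change (σ.erase v).card = i
    rw [Finset.card_erase_of_mem hv, show σ.card = i + 1 from hσ, Nat.add_sub_cancel]) hz

variable (Δ : AbstractSimplicialComplex (Fin n))

theorem simplices_subset_card (i : ℕ) : simplices Δ i ⊆ {σ | σ.card = i} := fun _ h => h.2

/-- If the Koszul module is supported away from `a ≠ 0`, then the specialization at `a` is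
exact. -/
theorem exactAt_of_mem_annihilator {i : ℕ} (hfull : simplices Δ i = {σ | σ.card = i})
    {a : Fin n → k} {u : Fin n} (hu : a u ≠ 0) {f : MvPolynomial (Fin n) k}
    (hf : f ∈ Module.annihilator (MvPolynomial (Fin n) k) (KoszulModule k Δ i))
    (hfa : MvPolynomial.eval a f ≠ 0) : ExactAt a (simplices Δ i) (simplices Δ (i + 1)) := by
  intro z hz h0
  rw [hfull] at hz
  -- The constant lift of `z` need not be a cycle over `S`. Writing `z` as the boundary of a chain
  -- `w` of arbitrary sets and lifting `w` instead gives one.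
  obtain ⟨w, hw, rfl⟩ := exactAt_card hu i z hz h0
  obtain ⟨y, hy, e⟩ := (mem_annihilator_koszulModule_iff k Δ f).mp hf
    (twistedBoundary MvPolynomial.X (constChain w))
    (by rw [hfull]; exact twistedBoundary_mem_card (constChain_mem hw))
    (twistedBoundary_twistedBoundary _ _)
  have e' := congrArg (evalChain a) e
  rw [evalChain_smul, evalChain_twistedBoundary, evalChain_twistedBoundary,
    evalChain_constChain] at e'
  exact ⟨(MvPolynomial.eval a f)⁻¹ • evalChain a y, Submodule.smul_mem _ _ (evalChain_mem hy), by
    rw [map_smul, e', smul_smul, inv_mul_cancel₀ hfa, one_smul]⟩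

/-- If the specialization at `a ≠ 0` is exact, then the Koszul module is supported away
from `a`. -/
theorem exists_mem_annihilator_of_exactAt {i : ℕ} (hfull : simplices Δ i = {σ | σ.card = i})
    {a : Fin n → k} {u : Fin n} (hu : a u ≠ 0)
    (h : ExactAt a (simplices Δ i) (simplices Δ (i + 1))) :
    ∃ f ∈ Module.annihilator (MvPolynomial (Fin n) k) (KoszulModule k Δ i),
      MvPolynomial.eval a f ≠ 0 := by
  let S := MvPolynomial (Fin n) k
  let tb : (Finset (Fin n) →₀ S) →ₗ[S] (Finset (Fin n) →₀ S) := twistedBoundary MvPolynomial.X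
  let Z : Submodule S (Finset (Fin n) →₀ S) := Finsupp.supported S S (simplices Δ i) ⊓ tb.ker
  let B : Submodule S (Finset (Fin n) →₀ S) := (Finsupp.supported S S (simplices Δ (i + 1))).map tb
  let I : Ideal S := RingHom.ker (MvPolynomial.eval a)
  have hsum : ∀ m : Finset (Fin n) →₀ S, ∑ σ ∈ m.support, m σ • Finsupp.single σ (1 : S) = m := by
    intro m
    conv_rhs => rw [← Finsupp.sum_single m, Finsupp.sum]
    simp only [Finsupp.smul_single, smul_eq_mul, mul_one]
  have hsingle : ∀ σ : Finset (Fin n), σ.card = i + 1 → tb (Finsupp.single σ 1) ∈ Z := by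
    intro σ hσ
    refine ⟨?_, twistedBoundary_twistedBoundary _ _⟩
    rw [hfull]
    exact twistedBoundary_mem_card (Finsupp.single_mem_supported _ _ hσ)
  have hI : ∀ q ∈ Finsupp.supported S S {σ : Finset (Fin n) | σ.card = i + 1},
      evalChain a q = 0 → tb q ∈ I • Z := by
    intro q hq h0
    rw [← hsum q, map_sum]
    refine Submodule.sum_mem _ fun σ hσ => ?_
    rw [map_smul]
    exact Submodule.smul_mem_smul (DFunLike.congr_fun h0 σ) (hsingle σ (hq hσ))
  -- Modulo the ideal `I` of the point, boundaries of arbitrary `(i+1)`-sets are boundaries of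
  -- faces: exactness at `a` replaces `[σ]` by a face chain `y`, and `[σ] - y` is a boundary at `a`
  -- in the full complex.
  have hB : ∀ m ∈ Finsupp.supported S S {σ : Finset (Fin n) | σ.card = i + 1},
      tb m ∈ B ⊔ I • Z := by
    intro m hm
    rw [← hsum m, map_sum]
    refine Submodule.sum_mem _ fun σ hσ => ?_
    rw [map_smul]
    refine Submodule.smul_mem _ _ ?_
    have hw : Finsupp.single σ (1 : k) ∈ Finsupp.supported k k {σ : Finset (Fin n) | σ.card = i + 1} :=
      Finsupp.single_mem_supported _ _ (hm hσ)
    obtain ⟨y, hy, e⟩ := h (twistedBoundary a (Finsupp.single σ 1))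
      (by rw [hfull]; exact twistedBoundary_mem_card hw) (twistedBoundary_twistedBoundary _ _)
    have hy' := Finsupp.supported_mono (simplices_subset_card Δ (i + 1)) hy
    obtain ⟨v, hv, e'⟩ := exactAt_card hu (i + 1) _ (sub_mem hw hy') (by rw [map_sub, e, sub_self])
    have hq : evalChain a (constChain (Finsupp.single σ 1) - constChain y - tb (constChain v))
        = 0 := by
      rw [evalChain_sub, evalChain_sub, evalChain_twistedBoundary]
      simp only [evalChain_constChain]
      rw [e', sub_self]
    have := hI _ (sub_mem (sub_mem (constChain_mem hw) (constChain_mem hy'))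
      (twistedBoundary_mem_card (constChain_mem hv))) hq
    rw [map_sub, map_sub, show tb (tb (constChain v)) = 0 from twistedBoundary_twistedBoundary _ _,
      sub_zero] at this
    have h1 : constChain (Finsupp.single σ (1 : k)) = Finsupp.single σ (1 : S) := by
      simp [constChain]
    rw [← h1, ← sub_add_cancel (tb (constChain (Finsupp.single σ 1))) (tb (constChain y))]
    exact add_mem (Submodule.mem_sup_right this)
      (Submodule.mem_sup_left ⟨_, constChain_mem hy, rfl⟩)
  -- The Nakayama hypothesis `W_i = I W_i`: `X_u` maps a cycle into `B + I Z` by the cone formula,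
  -- and `X_u` is the unit `a_u` modulo `I`.
  have hN : Z.map B.mkQ ≤ I • Z.map B.mkQ := by
    rintro _ ⟨z, hz, rfl⟩
    have hcone : MvPolynomial.X u • z = tb (coneOp S u z) :=
      smul_eq_twistedBoundary_coneOp (a := (MvPolynomial.X : Fin n → S)) hz.2 u
    have hmem : tb (coneOp S u z) ∈ B ⊔ I • Z := by
      refine hB _ (coneOp_mem (fun σ hσ huσ => ?_) hz.1)
      change (insert u σ).card = i + 1
      rw [Finset.card_insert_of_notMem huσ, hσ.2]
    have hle : (B ⊔ I • Z).map B.mkQ ≤ I • Z.map B.mkQ := by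
      rw [Submodule.map_sup, Submodule.map_smul'', Submodule.mkQ_map_self, bot_sup_eq]
    have h1 : B.mkQ ((MvPolynomial.X u : S) • z) ∈ I • Z.map B.mkQ :=
      hle ⟨_, hcone ▸ hmem, rfl⟩
    have hX : (MvPolynomial.X u - MvPolynomial.C (a u) : MvPolynomial (Fin n) k) ∈ I := by
      change MvPolynomial.eval a _ = 0
      rw [map_sub, MvPolynomial.eval_X, MvPolynomial.eval_C, sub_self]
    have h2 : (MvPolynomial.X u - MvPolynomial.C (a u) : S) • B.mkQ z ∈ I • Z.map B.mkQ :=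
      Submodule.smul_mem_smul hX ⟨z, hz, rfl⟩
    have h3 : B.mkQ z = (MvPolynomial.C (a u)⁻¹ : S) • (B.mkQ ((MvPolynomial.X u : S) • z)
        - (MvPolynomial.X u - MvPolynomial.C (a u) : S) • B.mkQ z) := by
      rw [map_smul, sub_smul, sub_sub_cancel, smul_smul, ← MvPolynomial.C_mul,
        inv_mul_cancel₀ hu, MvPolynomial.C_1, one_smul]
    rw [h3]
    exact Submodule.smul_mem _ _ (sub_mem h1 h2)
  -- The determinant form of Nakayama yields an annihilator `r` with `r(a) = 1`.
  obtain ⟨r, hr, hr0⟩ := Submodule.exists_sub_one_mem_and_smul_eq_zero_of_fg_of_le_smul I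
    (Z.map B.mkQ) ((IsNoetherian.noetherian Z).map _) hN
  refine ⟨r, (mem_annihilator_koszulModule_iff k Δ r).mpr fun z hz h0 => ?_, ?_⟩
  · have := hr0 _ ⟨z, ⟨hz, h0⟩, rfl⟩
    rw [← map_smul, Submodule.mkQ_apply, Submodule.Quotient.mk_eq_zero] at this
    exact this
  · have : MvPolynomial.eval a (r - 1) = 0 := hr
    rw [map_sub, map_one, sub_eq_zero] at this
    rw [this]
    exact one_ne_zero

theorem mem_supportResonance_iff_mem_jumpResonance {i : ℕ}
    (hfull : simplices Δ i = {σ | σ.card = i}) {a : Fin n → k} (ha : a ≠ 0) :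
    a ∈ supportResonance k Δ i ↔ a ∈ jumpResonance k Δ i := by
  obtain ⟨u, hu⟩ := Function.ne_iff.mp ha
  rw [mem_supportResonance_iff, mem_jumpResonance_iff]
  constructor
  · intro h hex
    obtain ⟨f, hf, hfa⟩ := exists_mem_annihilator_of_exactAt Δ hfull hu hex
    exact hfa (h f hf)
  · intro h f hf
    by_contra hfa
    exact h (exactAt_of_mem_annihilator Δ hfull hu hf hfa)

theorem zero_mem_jumpResonance {i : ℕ} (h : (simplices Δ i).Nonempty) :
    (0 : Fin n → k) ∈ jumpResonance k Δ i := by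
  obtain ⟨σ, hσ⟩ := h
  rw [mem_jumpResonance_iff]
  intro hex
  obtain ⟨y, -, e⟩ := hex (Finsupp.single σ 1) (Finsupp.single_mem_supported _ _ hσ)
    (twistedBoundary_zero _)
  rw [twistedBoundary_zero, eq_comm, Finsupp.single_eq_zero] at e
  exact one_ne_zero e

/-- If `f [∅]` is a boundary over `S`, evaluating at the origin, where the differential is zero,
gives `f(0) = 0`. -/
theorem zero_mem_supportResonance_zero : (0 : Fin n → k) ∈ supportResonance k Δ 0 := by
  rw [mem_supportResonance_iff]
  intro f hf
  have hz : Finsupp.single ∅ (1 : MvPolynomial (Fin n) k) ∈ Finsupp.supported _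
      (MvPolynomial (Fin n) k) (simplices Δ 0) :=
    Finsupp.single_mem_supported _ _ ⟨Or.inl rfl, rfl⟩
  obtain ⟨y, -, e⟩ := (mem_annihilator_koszulModule_iff k Δ f).mp hf _ hz
    (twistedBoundary_eq_zero_of_simplices_zero Δ _ hz)
  have := DFunLike.congr_fun (congrArg (evalChain (0 : Fin n → k)) e) ∅
  rw [evalChain_twistedBoundary, twistedBoundary_zero, evalChain_smul] at this
  simpa [evalChain] using this.symm

theorem smul_mem_jumpResonance {i : ℕ} {a : Fin n → k} (ha : a ∈ jumpResonance k Δ i) {t : k}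
    (ht : t ≠ 0) : t • a ∈ jumpResonance k Δ i := by
  rw [mem_jumpResonance_iff] at ha ⊢
  intro h
  refine ha ?_
  have := h.smul (inv_mul_cancel₀ ht)
  rwa [smul_smul, inv_mul_cancel₀ ht, one_smul] at this

/-- Away from the origin the locus is stable under nonzero scalars, being the jump locus there; a
polynomial vanishing on a punctured line through `0` vanishes at `0`. -/
theorem zero_mem_supportResonance_of_mem [Infinite k] {i : ℕ}
    (hfull : simplices Δ i = {σ | σ.card = i}) {a : Fin n → k} (ha : a ∈ supportResonance k Δ i) :
    (0 : Fin n → k) ∈ supportResonance k Δ i := by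
  by_cases h0 : a = 0
  · rwa [← h0]
  have hj := (mem_supportResonance_iff_mem_jumpResonance Δ hfull h0).mp ha
  rw [mem_supportResonance_iff]
  intro f hf
  refine eval_eq_zero_of_line f 0 a (Set.finite_singleton 0) fun t ht => ?_
  have ht : t ≠ 0 := ht
  rw [zero_add]
  exact (mem_supportResonance_iff Δ i _).mp ((mem_supportResonance_iff_mem_jumpResonance Δ hfull
    (smul_ne_zero ht h0)).mpr (smul_mem_jumpResonance Δ hj ht)) f hf

theorem supportResonance_eq_empty_of_cycles {i : ℕ}
    (h : ∀ z ∈ Finsupp.supported (MvPolynomial (Fin n) k) (MvPolynomial (Fin n) k) (simplices Δ i),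
      twistedBoundary MvPolynomial.X z = 0 → z = 0) : supportResonance k Δ i = ∅ := by
  refine Set.eq_empty_of_forall_notMem fun a ha => ?_
  refine one_ne_zero (α := k) ?_
  rw [← map_one (MvPolynomial.eval a)]
  refine (mem_supportResonance_iff Δ i a).mp ha 1 ?_
  exact (mem_annihilator_koszulModule_iff k Δ 1).mpr fun z hz h0 =>
    ⟨0, zero_mem _, by rw [h z hz h0]; simp⟩

/-- With no incoming chains, homology is a submodule of a free module over a domain: either it is
zero or only `0` annihilates it. -/
theorem supportResonance_top_degree {i : ℕ} (h : simplices Δ (i + 1) = ∅) :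
    supportResonance k Δ i = ∅ ∨ supportResonance k Δ i = Set.univ := by
  by_cases hz : ∀ z ∈ Finsupp.supported (MvPolynomial (Fin n) k) (MvPolynomial (Fin n) k)
      (simplices Δ i), twistedBoundary MvPolynomial.X z = 0 → z = 0
  · exact Or.inl (supportResonance_eq_empty_of_cycles Δ hz)
  · right
    push Not at hz
    obtain ⟨z, hz, h0, hne⟩ := hz
    refine Set.eq_univ_of_forall fun a => (mem_supportResonance_iff Δ i a).mpr fun f hf => ?_
    obtain ⟨y, hy, e⟩ := (mem_annihilator_koszulModule_iff k Δ f).mp hf z hz h0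
    rw [h, Finsupp.supported_empty, Submodule.mem_bot] at hy
    rw [hy, map_zero, eq_comm, smul_eq_zero] at e
    rw [e.resolve_right hne, map_zero]

theorem resonance_eq_empty {i : ℕ} (h : simplices Δ i = ∅) :
    supportResonance k Δ i = ∅ ∧ jumpResonance k Δ i = ∅ := by
  constructor
  · refine supportResonance_eq_empty_of_cycles Δ fun z hz _ => ?_
    rwa [h, Finsupp.supported_empty, Submodule.mem_bot] at hz
  · refine Set.eq_empty_of_forall_notMem fun a ha => ?_
    rw [mem_jumpResonance_iff] at ha
    refine ha fun z hz _ => ⟨0, zero_mem _, ?_⟩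
    rw [h, Finsupp.supported_empty, Submodule.mem_bot] at hz
    rw [hz, map_zero]

end Specialization

/-! ### The components of the jump resonance locus -/

section Components

variable {k : Type*} [Field k] {n : ℕ} (Δ : AbstractSimplicialComplex (Fin n))

theorem chains_restrict (V : Finset (Fin n)) (i : ℕ) {q : ℤ} (hq : q + 1 = i) :
    chains k (restrict Δ V) q = Finsupp.supported k k (simplices Δ i ∩ {σ | σ ⊆ V}) := by
  rw [chains]
  congr 1
  ext σ
  change (σ = ∅ ∨ σ ∈ Δ ∧ σ ⊆ V) ∧ (σ.card : ℤ) = q + 1 ↔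
    ((σ = ∅ ∨ σ ∈ Δ) ∧ σ.card = i) ∧ σ ⊆ V
  rw [hq, Nat.cast_inj]
  constructor
  · rintro ⟨rfl | h, hc⟩
    · exact ⟨⟨Or.inl rfl, hc⟩, Finset.empty_subset V⟩
    · exact ⟨⟨Or.inr h.1, hc⟩, h.2⟩
  · rintro ⟨⟨h | h, hc⟩, hV⟩
    · exact ⟨Or.inl h, hc⟩
    · exact ⟨Or.inr ⟨h, hV⟩, hc⟩

/-- Simplices are counted by vertices here, hence the shift from `i` to dimension `i - 1`. -/
theorem nontrivial_reducedHomology_iff (V : Finset (Fin n)) (i : ℕ) :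
    Nontrivial (ReducedHomology k (restrict Δ V) ((i : ℤ) - 1)) ↔
      ¬ ExactAt (1 : Fin n → k) (simplices Δ i ∩ {σ | σ ⊆ V})
        (simplices Δ (i + 1) ∩ {σ | σ ⊆ V}) := by
  rw [nontrivial_subquotient_iff, cycles, boundaries, chains_restrict Δ V i (by ring),
    chains_restrict Δ V (i + 1) (by push_cast; ring), boundary_eq_twistedBoundary, not_iff_not]
  exact ⟨fun h z hz h0 => h ⟨hz, h0⟩, fun h z hz => h z hz.1 hz.2⟩

/-- Nowhere vanishing twists do not change exactness. -/
theorem ExactAt.of_ne_zero {a b : Fin n → k} (ha : ∀ v, a v ≠ 0) (hb : ∀ v, b v ≠ 0)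
    {P Q : Set (Finset (Fin n))} (h : ExactAt a P Q) : ExactAt b P Q :=
  h.rescale (a / b) (b / a) (by ext v; have := ha v; have := hb v; simp; field_simp)
    (by ext v; have := hb v; simp; field_simp)

theorem filter_mem_supported {R : Type*} [CommRing R] {P Q : Set (Finset (Fin n))}
    {p : Finset (Fin n) → Prop} [DecidablePred p] (h : ∀ σ ∈ P, p σ → σ ∈ Q) {z : Finset (Fin n) →₀ R}
    (hz : z ∈ Finsupp.supported R R P) : z.filter p ∈ Finsupp.supported R R Q := by
  intro σ hσ
  rw [Finset.mem_coe, Finsupp.support_filter, Finset.mem_filter] at hσ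
  exact h σ (hz hσ.1) hσ.2

/-- If all the restrictions of `Δ` to vertex sets containing the support of `a ≠ 0` are acyclic in
degree `d - 1`, then `a` is not in the jump resonance locus. -/
theorem exactAt_of_forall_restrict {d : ℕ} (hfull : simplices Δ d = {σ | σ.card = d})
    {a : Fin n → k} {u : Fin n} (hu : a u ≠ 0)
    (h : ∀ V : Finset (Fin n), (∀ v, a v ≠ 0 → v ∈ V) →
      ExactAt (1 : Fin n → k) (simplices Δ d ∩ {σ | σ ⊆ V}) (simplices Δ (d + 1) ∩ {σ | σ ⊆ V})) :
    ExactAt a (simplices Δ d) (simplices Δ (d + 1)) := by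
  classical
  let U : Finset (Fin n) := Finset.univ.filter fun v => a v ≠ 0
  have hU : ∀ v, v ∈ U ↔ a v ≠ 0 := by simp [U]
  -- A nowhere vanishing twist agreeing with `a` on its support `U`.
  let b : Fin n → k := fun v => if a v = 0 then 1 else a v
  have hb : ∀ v, b v ≠ 0 := by
    intro v; dsimp only [b]; split_ifs with h <;> simp [h]
  have hbU : ∀ v, a v ≠ 0 → b v = a v := fun v hv => if_neg hv
  -- Only vertices of `U` are removed with nonzero coefficient by `∂_a`, so `σ \ U` is preserved and
  -- the complex splits according to `τ = σ \ U`.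
  let p : Finset (Fin n) → Finset (Fin n) → Prop := fun τ σ => σ \ U = τ
  have hfilter : ∀ τ (w : Finset (Fin n) →₀ k),
      (twistedBoundary a w).filter (p τ) = twistedBoundary a (w.filter (p τ)) := by
    intro τ w
    refine filter_twistedBoundary (P := Set.univ) (fun σ _ v hv => ?_) (by simp)
    by_cases hv0 : a v = 0
    · simp [hv0]
    · have : p τ (σ.erase v) ↔ p τ σ := by
        dsimp only [p]
        rw [Finset.erase_sdiff_comm, Finset.erase_eq_of_notMem (by simp [hU, hv0])]
      simp only [this]
  -- Inside `U ∪ τ`, removing a vertex outside `U` destroys `σ \ U = τ`; hence the `τ`-part of `∂_b`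
  -- only sees `∂_a`.
  have hmixed : ∀ τ (w : Finset (Fin n) →₀ k), w ∈ Finsupp.supported k k {σ | σ ⊆ U ∪ τ} →
      (twistedBoundary b w).filter (p τ) = twistedBoundary a (w.filter (p τ)) := by
    intro τ w hw
    refine filter_twistedBoundary (fun σ hσ v hv => ?_) hw
    by_cases hv0 : a v = 0
    · have hvU : v ∉ U := by simp [hU, hv0]
      have hvτ : v ∈ τ := (Finset.mem_union.mp (hσ hv)).resolve_left hvU
      have : ¬ p τ (σ.erase v) := by
        intro hp
        have hv' : v ∈ σ.erase v \ U := by rw [show σ.erase v \ U = τ from hp]; exact hvτ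
        simp at hv'
      simp [hv0, this]
    · have : p τ (σ.erase v) ↔ p τ σ := by
        dsimp only [p]
        rw [Finset.erase_sdiff_comm, Finset.erase_eq_of_notMem (by simp [hU, hv0])]
      simp only [this, hbU v hv0]
  have hcone : ∀ τ (w : Finset (Fin n) →₀ k),
      (coneOp k u w).filter (p τ) = coneOp k u (w.filter (p τ)) := by
    intro τ w
    refine filter_coneOp (fun σ => ?_) w
    dsimp only [p]
    rw [Finset.insert_sdiff_of_mem _ ((hU u).mpr hu)]
  intro z hz h0
  have key : ∀ τ, ∃ y ∈ Finsupp.supported k k (simplices Δ (d + 1)),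
      twistedBoundary a y = z.filter (p τ) := by
    intro τ
    set V := U ∪ τ with hV
    set w := z.filter (p τ) with hw
    have hwa : twistedBoundary a w = 0 := by rw [hw, ← hfilter, h0, Finsupp.filter_zero]
    have hww : w.filter (p τ) = w := by
      rw [hw]; ext σ; simp +contextual [Finsupp.filter_apply]
    have hwV : w ∈ Finsupp.supported k k (simplices Δ d ∩ {σ | σ ⊆ V}) := by
      refine filter_mem_supported (Q := simplices Δ d ∩ {σ | σ ⊆ V})
        (fun σ hσ hp => ⟨hσ, fun v hv => ?_⟩) hz
      by_cases hvU : v ∈ U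
      · exact Finset.mem_union_left _ hvU
      · refine Finset.mem_union_right _ ?_
        rw [← show σ \ U = τ from hp]
        exact Finset.mem_sdiff.mpr ⟨hv, hvU⟩
    set y := twistedBoundary b w with hy
    have hyV : y ∈ Finsupp.supported k k {σ | σ.card + 1 = d ∧ σ ⊆ V} := by
      refine twistedBoundary_mem (Q := {σ | σ.card + 1 = d ∧ σ ⊆ V})
        (fun σ hσ v hv => ⟨?_, (Finset.erase_subset v σ).trans hσ.2⟩) hwV
      rw [Finset.card_erase_add_one hv, hσ.1.2]
    -- Coning the error `y = ∂_b w` gives sets with `d` vertices; they are faces because the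
    -- skeleton is complete.
    have hcV : coneOp k u y ∈ Finsupp.supported k k (simplices Δ d ∩ {σ | σ ⊆ V}) := by
      refine coneOp_mem (Q := simplices Δ d ∩ {σ | σ ⊆ V}) (fun σ hσ huσ => ⟨?_, ?_⟩) hyV
      · rw [hfull]
        change (insert u σ).card = d
        rw [Finset.card_insert_of_notMem huσ, hσ.1]
      · exact Finset.insert_subset (Finset.mem_union_left _ ((hU u).mpr hu)) hσ.2
    have hsub : ∀ {i : ℕ} {x : Finset (Fin n) →₀ k},
        x ∈ Finsupp.supported k k (simplices Δ i ∩ {σ | σ ⊆ V}) →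
          x ∈ Finsupp.supported k k {σ | σ ⊆ V} :=
      fun hx => Finsupp.supported_mono Set.inter_subset_right hx
    have hyp : y.filter (p τ) = 0 := by rw [hmixed τ w (hsub hwV), hww, hwa]
    have hbu : b u ≠ 0 := hb u
    -- Subtracting the cone on `y` makes `w` a `∂_b`-cycle, to which acyclicity of `Δ_V` applies.
    -- The correction has no `τ`-part, so the `τ`-part of `Y` has `∂_a`-boundary `w`.
    obtain ⟨Y, hY, e⟩ := (h V fun v hv => Finset.mem_union_left _ ((hU v).mpr hv)).of_ne_zero
      (fun _ => one_ne_zero) hb (w - (b u)⁻¹ • coneOp k u y)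
      (sub_mem hwV (Submodule.smul_mem _ _ hcV)) (by
        rw [map_sub, map_smul, twistedBoundary_coneOp, hy, twistedBoundary_twistedBoundary,
          map_zero, sub_zero, smul_smul, inv_mul_cancel₀ hbu, one_smul, sub_self])
    refine ⟨Y.filter (p τ), filter_mem_supported (fun σ hσ _ => hσ.1) hY, ?_⟩
    rw [← hmixed τ Y (hsub hY), e, Finsupp.filter_sub, Finsupp.filter_smul, hcone, hyp, map_zero,
      smul_zero, sub_zero, hww]
  choose y hy hya using key
  refine ⟨∑ τ, y τ, Submodule.sum_mem _ fun τ _ => hy τ, ?_⟩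
  rw [map_sum]
  ext σ
  rw [Finsupp.finsetSum_apply, Finset.sum_eq_single (σ \ U)]
  · rw [hya, Finsupp.filter_apply_pos]; rfl
  · intro τ _ hτ
    rw [hya, Finsupp.filter_apply_neg]
    exact hτ.symm
  · simp

/-- Points with support exactly `V` are in the jump resonance locus if `Δ_V` has homology. -/
theorem mem_jumpResonance_of_nontrivial {i : ℕ} {V : Finset (Fin n)}
    (h : Nontrivial (ReducedHomology k (restrict Δ V) ((i : ℤ) - 1))) {a : Fin n → k}
    (ha : ∀ v, a v ≠ 0 ↔ v ∈ V) : a ∈ jumpResonance k Δ i := by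
  rw [nontrivial_reducedHomology_iff] at h
  rw [mem_jumpResonance_iff]
  refine fun hex => h ?_
  classical
  let b : Fin n → k := fun v => if a v = 0 then 1 else a v
  have hb : ∀ v, b v ≠ 0 := by
    intro v; dsimp only [b]; split_ifs with h <;> simp [h]
  have hcongr : ∀ {j : ℕ} {x : Finset (Fin n) →₀ k},
      x ∈ Finsupp.supported k k (simplices Δ j ∩ {σ | σ ⊆ V}) →
        twistedBoundary b x = twistedBoundary a x := fun hx =>
    twistedBoundary_congr (fun σ hσ v hv => if_neg ((ha v).mpr (hσ.2 hv))) hx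
  refine ExactAt.of_ne_zero hb (fun _ => one_ne_zero) fun z hz h0 => ?_
  obtain ⟨y, hy, e⟩ := hex z (Finsupp.supported_mono Set.inter_subset_left hz)
    ((hcongr hz).symm.trans h0)
  have hy' : y.filter (· ⊆ V) ∈ Finsupp.supported k k (simplices Δ (i + 1) ∩ {σ | σ ⊆ V}) :=
    filter_mem_supported (Q := simplices Δ (i + 1) ∩ {σ | σ ⊆ V}) (fun σ hσ hp => ⟨hσ, hp⟩) hy
  refine ⟨_, hy', ?_⟩
  -- Vertices removed by `∂_a` lie in `V`, so removal does not change whether a face is inside `V`,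
  -- and discarding the faces outside `V` commutes with `∂_a`.
  rw [hcongr hy', ← filter_twistedBoundary (b := a) (P := Set.univ) _ (by simp), e]
  · rw [Finsupp.filter_eq_self_iff]
    exact fun σ hσ => (hz (Finsupp.mem_support_iff.mpr hσ)).2
  · intro σ _ v hv
    by_cases hv0 : a v = 0
    · simp [hv0]
    · have : σ.erase v ⊆ V ↔ σ ⊆ V := by
        rw [← Finset.subset_insert_iff, Finset.insert_eq_of_mem ((ha v).mp hv0)]
      simp only [this]

theorem mem_coordSubspace_iff (V : Finset (Fin n)) (a : Fin n → k) :
    a ∈ coordSubspace k V ↔ ∀ v ∉ V, a v = 0 := by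
  constructor
  · intro h v hv
    induction h using Submodule.span_induction with
    | zero => rfl
    | add x y _ _ hx hy => simp [hx, hy]
    | smul c x _ hx => simp [hx]
    | mem x hx =>
      obtain ⟨j, hj, rfl⟩ := hx
      exact Pi.single_eq_of_ne (fun e => hv (by rw [e]; exact hj)) _
  · intro h
    have ha : a = ∑ v, a v • Pi.single v (1 : k) := by
      ext w; simp [Finset.sum_apply, Pi.single_apply]
    rw [ha]
    refine Submodule.sum_mem _ fun v _ => ?_
    by_cases hv : v ∈ V
    · exact Submodule.smul_mem _ _ (Submodule.subset_span ⟨v, hv, rfl⟩)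
    · rw [h v hv, zero_smul]; exact zero_mem _

/-- The point is a limit, along the line in the direction of the indicator of `V`, of points with
support exactly `V`. Closedness holds for the support locus, so the argument passes through it. -/
theorem mem_jumpResonance_of_mem_coordSubspace [Infinite k] {i : ℕ}
    (hfull : simplices Δ i = {σ | σ.card = i}) {V : Finset (Fin n)}
    (h : Nontrivial (ReducedHomology k (restrict Δ V) ((i : ℤ) - 1))) {a : Fin n → k} (h0 : a ≠ 0)
    (ha : a ∈ coordSubspace k V) : a ∈ jumpResonance k Δ i := by
  classical
  rw [mem_coordSubspace_iff] at ha
  rw [← mem_supportResonance_iff_mem_jumpResonance Δ hfull h0, mem_supportResonance_iff]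
  intro f hf
  let c : Fin n → k := fun v => if v ∈ V then 1 else 0
  -- The excluded parameters contain all those at which a coordinate in `V` vanishes.
  refine eval_eq_zero_of_line f a c (Set.finite_range fun v => -a v) fun t ht => ?_
  have hsupp : ∀ v, (a + t • c) v ≠ 0 ↔ v ∈ V := by
    intro v
    by_cases hv : v ∈ V
    · refine ⟨fun _ => hv, fun _ e => ht ⟨v, ?_⟩⟩
      simp only [c, Pi.add_apply, Pi.smul_apply, if_pos hv, smul_eq_mul, mul_one] at e
      linear_combination -e
    · simp [c, hv, ha v hv]
  have hne : a + t • c ≠ 0 := by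
    obtain ⟨u, hu⟩ := Function.ne_iff.mp h0
    exact Function.ne_iff.mpr ⟨u, (hsupp u).mpr (by_contra fun hV => hu (ha u hV))⟩
  exact (mem_supportResonance_iff Δ i _).mp ((mem_supportResonance_iff_mem_jumpResonance Δ hfull
    hne).mpr (mem_jumpResonance_of_nontrivial Δ h hsupp)) f hf

theorem exists_maximal_of_mem_jumpResonance {i : ℕ} (hfull : simplices Δ i = {σ | σ.card = i})
    {a : Fin n → k} (h0 : a ≠ 0) (ha : a ∈ jumpResonance k Δ i) :
    ∃ V, Maximal (fun V => Nontrivial (ReducedHomology k (restrict Δ V) ((i : ℤ) - 1))) V ∧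
      a ∈ coordSubspace k V := by
  obtain ⟨u, hu⟩ := Function.ne_iff.mp h0
  rw [mem_jumpResonance_iff] at ha
  have := mt (exactAt_of_forall_restrict Δ hfull hu) ha
  push Not at this
  obtain ⟨V, hV, hex⟩ := this
  rw [← nontrivial_reducedHomology_iff] at hex
  obtain ⟨V', hle, hmax⟩ := (Set.toFinite {V | Nontrivial
    (ReducedHomology k (restrict Δ V) ((i : ℤ) - 1))}).exists_le_maximal hex
  exact ⟨V', hmax, (mem_coordSubspace_iff V' a).mpr fun v hv =>
    by_contra fun hne => hv (hle (hV v hne))⟩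

theorem simplices_eq_setOf_card {d : ℕ}
    (hskel : ∀ σ : Finset (Fin n), σ.Nonempty → σ.card ≤ d → σ ∈ Δ) {i : ℕ} (hi : i ≤ d) :
    simplices Δ i = {σ | σ.card = i} :=
  Set.Subset.antisymm (simplices_subset_card Δ i) fun σ hσ =>
    ⟨σ.eq_empty_or_nonempty.imp_right fun h => hskel σ h (le_of_eq_of_le hσ hi), hσ⟩

end Components

end Resonance

end

/-! ### The resonance loci by degree, and the components in degree `d`. -/

theorem corollary6p5 {k : Type*} [Field k] [CharZero k] {n d : ℕ} (hd : 1 ≤ d)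
    (Δ : AbstractSimplicialComplex (Fin n))
    (hdim_le : ∀ σ ∈ Δ, σ.card ≤ d + 1)
    (hdim : ∃ σ ∈ Δ, σ.card = d + 1)
    (hskel : ∀ σ : Finset (Fin n), σ.Nonempty → σ.card ≤ d → σ ∈ Δ) :
    (∀ i : ℕ, i ≠ d + 1 →
      Resonance.supportResonance k Δ i \ {0} = Resonance.jumpResonance k Δ i \ {0} ∧
      (Resonance.supportResonance k Δ i = Resonance.jumpResonance k Δ i ∨
        (1 ≤ i ∧ i ≤ d ∧ Resonance.supportResonance k Δ i = ∅ ∧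
          Resonance.jumpResonance k Δ i = {0}))) ∧
    (Resonance.supportResonance k Δ (d + 1) = ∅ ∨
      Resonance.supportResonance k Δ (d + 1) = Set.univ) ∧
    Resonance.jumpResonance k Δ d =
      {0} ∪ ⋃ V' ∈ {V' : Finset (Fin n) | Maximal
          (fun V'' => Nontrivial
            (Resonance.ReducedHomology k (Resonance.restrict Δ V'') ((d : ℤ) - 1))) V'},
        (Resonance.coordSubspace k V' : Set (Fin n → k)) := by
  have hempty : ∀ i, d + 1 < i → Resonance.simplices Δ i = ∅ := by
    intro i hi
    refine Set.eq_empty_of_forall_notMem fun σ hσ => ?_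
    rcases hσ.1 with rfl | h
    · have := hσ.2; simp at this; omega
    · have := hdim_le σ h; have := hσ.2; omega
  have hzero : ∀ i, i ≤ d → (0 : Fin n → k) ∈ Resonance.jumpResonance k Δ i := by
    intro i hi
    obtain ⟨σ, -, hσ⟩ := hdim
    obtain ⟨τ, -, hτ⟩ := Finset.exists_subset_card_eq (s := σ) (n := i) (by omega)
    refine Resonance.zero_mem_jumpResonance Δ ⟨τ, ?_⟩
    rw [Resonance.simplices_eq_setOf_card Δ hskel hi]
    exact hτ
  refine ⟨fun i hi => ?_, ?_, ?_⟩
  · rcases lt_or_gt_of_ne hi with hi | hi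
    · have hid : i ≤ d := by omega
      have hfull := Resonance.simplices_eq_setOf_card Δ hskel hid
      have hiff : ∀ a : Fin n → k, a ≠ 0 →
          (a ∈ Resonance.supportResonance k Δ i ↔ a ∈ Resonance.jumpResonance k Δ i) :=
        fun a ha => Resonance.mem_supportResonance_iff_mem_jumpResonance Δ hfull ha
      refine ⟨Set.ext fun a => and_congr_left fun ha => hiff a ha, ?_⟩
      -- The loci can differ only at the origin; if the support locus misses it, the cone property
      -- makes that locus empty and leaves only `0` in the jump locus.
      by_cases h0 : (0 : Fin n → k) ∈ Resonance.supportResonance k Δ i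
      · left
        ext a
        by_cases ha : a = 0
        · subst ha; exact iff_of_true h0 (hzero i hid)
        · exact hiff a ha
      · have hS : Resonance.supportResonance k Δ i = ∅ :=
          Set.eq_empty_of_forall_notMem fun a ha =>
            h0 (Resonance.zero_mem_supportResonance_of_mem Δ hfull ha)
        refine Or.inr ⟨?_, hid, hS, ?_⟩
        · rw [Nat.one_le_iff_ne_zero]
          rintro rfl
          exact h0 (Resonance.zero_mem_supportResonance_zero Δ)
        · refine Set.Subset.antisymm (fun a ha => ?_) (Set.singleton_subset_iff.mpr (hzero i hid))
          by_contra hne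
          have := (hiff a hne).mpr ha
          rw [hS] at this
          exact this
    · obtain ⟨h₁, h₂⟩ := Resonance.resonance_eq_empty (k := k) Δ (hempty i hi)
      rw [h₁, h₂]
      exact ⟨rfl, Or.inl rfl⟩
  · exact Resonance.supportResonance_top_degree Δ (hempty _ (by omega))
  · have hfull := Resonance.simplices_eq_setOf_card Δ hskel le_rfl
    ext a
    simp only [Set.mem_union, Set.mem_singleton_iff, Set.mem_iUnion, exists_prop, SetLike.mem_coe,
      Set.mem_ofPred_eq]
    by_cases ha : a = 0
    · subst ha; exact iff_of_true (hzero d le_rfl) (Or.inl rfl)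
    · constructor
      · exact fun h => Or.inr (Resonance.exists_maximal_of_mem_jumpResonance Δ hfull ha h)
      · rintro (h | ⟨V, hV, haV⟩)
        · exact absurd h ha
        · exact Resonance.mem_jumpResonance_of_mem_coordSubspace Δ hfull hV.prop ha haV
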